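/- Let $K$ be a field, $c\ge 1$ and $i\ge 0$ integers, and put $R=K[x_{k,j}\mid 1\le k\le c,\ j\ge 1]$ and $R_n=K[x_{k,j}\mid 1\le k\le c,\ 1\le j\le n]$ for $n\ge1$. Let $\mathrm{Inc}(\mathbb N)^i$ be the monoid of strictly increasing maps $\pi:\{1,2,\dots\}\to\{1,2,\dots\}$ with $\pi(j)=j$ for all $j\le i$, acting on $R$ by $\pi(x_{k,j})=x_{k,\pi(j)}$. Let $\mathcal I=(I_n)_{n\ge1}$ be a sequence of graded ideals $I_n\subseteq R_n$, not all zero, that is $\mathrm{Inc}(\mathbb N)^i$-invariant, i.e. $\pi(I_m)\subseteq I_n$ whenever $m\le n$, $\pi\in \mathrm{Inc}(\mathbb N)^i$ and $\pi(m)\le n$. Let $\le$ be a monomial order on $R$ (a total order on the monomials, compatible with multiplication, with least element $1$) that respects $\mathrm{Inc}(\mathbb N)^i$, i.e. $u\le v$ implies $\pi(u)\le\pi(v)$ for all monomials $u,v$ and all $\pi\in\mathrm{Inc}(\mathbb N)^i$. Denote by $\mathrm{in}_\le(\mathcal I)=(\mathrm{in}_\le(I_n))_{n\ge1}$ the sequence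 of initial ideals. For a nonzero monomial ideal $J\subseteq R_n$ let $G(J)$ be its minimal set of monomial generators, and for $p\ge0$ let $G^{(p)}_+(J)$ be the set of those $u\in G(J)$ with $u\neq1$ that are divisible by no variable $x_{k,j}$ with $j\le p$. For a monomial $u\in R_n$ let $w^{(p)}_k(u)$ be the largest exponent in $u$ of a variable $x_{k,j}$ with $p<j\le n$ (and $0$ if there is none), and $w^{(p)}(u)=\max_k w_k^{(p)}(u)$. Put $w_k^{(p)}(J)=\max\{w_k^{(p)}(u)\mid u\in G(J)\}$, and let $\omega^{(p)}(J)$ be $\min\{w^{(p)}(u)\mid u\in G_+^{(p)}(J)\}$ if $G_+^{(p)}(J)\neq\emptyset$ and $\max\{w^{(p)}(u)\mid u\in G(J)\}$ otherwise. Then there are integers $\omega,w_1,\dots,w_c\ge0$ such that for all sufficiently large $p$ and all sufficiently large $n$ (depending on $p$) one has $\omega^{(p)}(\mathrm{in}_\le(I_n))=\omega$ and $w_k^{(p)}(\mathrm{in}_\le(I_n))=w_k$ for $1\le k\le c$; and, with $$C(\mathrm{in}_\le(\mathcal I))=\max\{\omega-1,0\}+\max\Big\{\sum_{k\neq l}w_k\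 \Big|\ 1\le l\le c\Big\},$$ there is a constant $D\in\mathbb Z$ such that $$\mathrm{reg}(I_n)\le C(\mathrm{in}_\le(\mathcal I))\,n+D\qquad\text{for all } n\gg0,$$ where $\mathrm{reg}(I_n)=\max\{q-p\mid \mathrm{Tor}_p^{R_n}(K,I_n)_q\neq0\}$ is the Castelnuovo-Mumford regularity. -/

import Mathlib

open Filter MvPolynomial

noncomputable section

/-! ### Koszul complex, graded Tor and regularity of an ideal of a polynomial ring -/

section Regularity

variable {K σ : Type*} [Field K] [Fintype σ] [LinearOrder σ]

/-- The Koszul differential of `S = K[σ]`. A chain `∑ f A • e_A` (with `e_A` the wedge of the basis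
vectors in `A`, in increasing order) is stored as the function `A ↦ f A`, and
`e_A ↦ ∑_{v ∈ A} (-1)^{#{a ∈ A | a < v}} x_v e_{A \ v}`. -/
def koszulD : (Finset σ → MvPolynomial σ K) →ₗ[K] (Finset σ → MvPolynomial σ K) where
  toFun f B := ∑ v ∈ Finset.univ \ B,
    (-1) ^ (B.filter (· < v)).card * (X v * f (insert v B))
  map_add' f g := by
    funext B
    simp only [Pi.add_apply, mul_add, Finset.sum_add_distrib]
  map_smul' r f := by
    funext B
    simp only [Pi.smul_apply, RingHom.id_apply, Finset.smul_sum, mul_smul_comm]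

/-- The Koszul differential squares to zero. -/
theorem koszulD_comp (f : Finset σ → MvPolynomial σ K) : koszulD (koszulD f) = 0 := by
  funext B
  simp only [koszulD, LinearMap.coe_mk, AddHom.coe_mk, Pi.zero_apply, Finset.mul_sum]
  rw [Finset.sum_sigma']
  refine Finset.sum_involution (fun x _ => ⟨x.2, x.1⟩) ?_ ?_ ?_ ?_
  · rintro ⟨v, w⟩ h
    simp only [Finset.mem_sigma, Finset.mem_sdiff, Finset.mem_univ, true_and, Finset.mem_insert, not_or] at h
    obtain ⟨hv, hwv, hw⟩ := h
    simp only [Finset.insert_comm w v B, Finset.filter_insert]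
    rcases lt_or_gt_of_ne hwv with h | h
    · rw [if_neg h.not_gt, if_pos h, Finset.card_insert_of_notMem (by simp [hw])]
      ring
    · rw [if_pos h, if_neg h.not_gt, Finset.card_insert_of_notMem (by simp [hv])]
      ring
  · rintro ⟨v, w⟩ h _ heq
    simp only [Finset.mem_sigma, Finset.mem_sdiff, Finset.mem_univ, true_and, Finset.mem_insert, not_or] at h
    simp only [Sigma.mk.injEq, heq_eq_eq] at heq
    exact h.2.1 heq.1
  · rintro ⟨v, w⟩ h
    simp only [Finset.mem_sigma, Finset.mem_sdiff, Finset.mem_univ, true_and, Finset.mem_insert, not_or] at h ⊢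
    exact ⟨h.2.2, fun e => h.2.1 e.symm, h.1⟩
  · rintro ⟨v, w⟩ h; rfl

/-- The part of internal degree `j` of the Koszul chains in homological degree `p` with
coefficients in the ideal `I`: `e_A` sits in homological and internal degree `#A`. -/
def koszulChains (I : Ideal (MvPolynomial σ K)) (p j : ℕ) :
    Submodule K (Finset σ → MvPolynomial σ K) where
  carrier := {f | ∀ A, f A ∈ I ∧ (f A ≠ 0 → A.card = p) ∧ ∀ s ∈ (f A).support, s.degree + p = j}
  zero_mem' A := by simp
  add_mem' {f g} hf hg A := by
    classical
    refine ⟨I.add_mem (hf A).1 (hg A).1, fun h => ?_, fun s hs => ?_⟩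
    · by_cases h0 : f A = 0
      · exact (hg A).2.1 fun h1 => h (by simp [h0, h1])
      · exact (hf A).2.1 h0
    · rcases Finset.mem_union.1 (support_add hs) with h | h
      · exact (hf A).2.2 s h
      · exact (hg A).2.2 s h
  smul_mem' r f hf A := by
    refine ⟨?_, fun h => ?_, fun s hs => ?_⟩
    · simpa [smul_eq_C_mul] using I.mul_mem_left (C r) (hf A).1
    · exact (hf A).2.1 fun h1 => h (by simp [h1])
    · exact (hf A).2.2 s (support_smul hs)

/-- Koszul cycles of homological degree `p` and internal degree `j`. -/
def koszulCycles (I : Ideal (MvPolynomial σ K)) (p j : ℕ) :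
    Submodule K (Finset σ → MvPolynomial σ K) :=
  koszulChains I p j ⊓ LinearMap.ker koszulD

/-- Koszul boundaries of homological degree `p` and internal degree `j`. -/
def koszulBoundaries (I : Ideal (MvPolynomial σ K)) (p j : ℕ) :
    Submodule K (Finset σ → MvPolynomial σ K) :=
  (koszulChains I (p + 1) j).map koszulD

/-- `Tor_p^S(K, I)_j` for `S = K[σ]`, computed from the Koszul complex, which is the minimal graded
free resolution of `K` over `S`: the homology of (Koszul complex) `⊗_S I`. -/
abbrev gradedTor (I : Ideal (MvPolynomial σ K)) (p j : ℕ) : Type _ :=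
  koszulCycles I p j ⧸ (koszulBoundaries I p j).submoduleOf (koszulCycles I p j)

/-- Castelnuovo-Mumford regularity: the supremum of all `j - p` with `Tor_p^S(K, I)_j ≠ 0`
(so `⊥` for the zero ideal). -/
def regularity (I : Ideal (MvPolynomial σ K)) : EReal :=
  sSup {x | ∃ p j : ℕ, Nontrivial (gradedTor I p j) ∧ x = (((j : ℝ) - (p : ℝ) : ℝ) : EReal)}

/-- Graded ideals: closed under taking homogeneous components. -/
def IsGradedIdeal {τ : Type*} (J : Ideal (MvPolynomial τ K)) : Prop :=
  ∀ f ∈ J, ∀ d : ℕ, homogeneousComponent d f ∈ J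

end Regularity

/-! ### The rings `R_n ⊆ R` and the monoids `Inc(ℕ)^i`

The second index of a variable runs over `0, 1, 2, …` instead of `1, 2, 3, …`. -/

/-- Index set of the variables of `R_n`. -/
abbrev FinVar (c n : ℕ) : Type := Fin c ×ₗ Fin n

/-- Index set of the variables of `R`. -/
abbrev InfVar (c : ℕ) : Type := Fin c × ℕ

/-- The inclusion of the variables of `R_n` into those of `R`. -/
def varIncl (c n : ℕ) (v : FinVar c n) : InfVar c := ((ofLex v).1, ((ofLex v).2 : ℕ))

/-- The inclusion `R_n ⊆ R`. -/
def ringIncl (K : Type*) [Field K] (c n : ℕ) :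
    MvPolynomial (FinVar c n) K →ₐ[K] MvPolynomial (InfVar c) K :=
  rename (varIncl c n)

/-- `Inc(ℕ)^i`: strictly increasing maps that fix the first `i` indices. -/
def IncMonoid (i : ℕ) : Set (ℕ → ℕ) := {π | StrictMono π ∧ ∀ j < i, π j = j}

/-- The action of a map of indices on variables. -/
def varAct (c : ℕ) (π : ℕ → ℕ) (v : InfVar c) : InfVar c := (v.1, π v.2)

/-- `Inc(ℕ)^i`-invariance of a sequence of ideals `I n ⊆ R_n`, `n ≥ 1` (`I 0` plays no role):
`π(I_m) ⊆ I_n` whenever `π` maps the first `m` indices into the first `n` indices. -/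
def IsIncInvariant {K : Type*} [Field K] {c : ℕ} (i : ℕ)
    (I : (n : ℕ) → Ideal (MvPolynomial (FinVar c n) K)) : Prop :=
  ∀ m n : ℕ, 1 ≤ m → m ≤ n → ∀ π ∈ IncMonoid i, (∀ j < m, π j < n) →
    ∀ f ∈ I m, ∃ g ∈ I n, ringIncl K c n g = rename (varAct c π) (ringIncl K c m f)

/-! ### Monomial orders and initial ideals -/

/-- Monomial orders (on exponent vectors): total, multiplicative, with `1` as least element.
A well-order on all monomials is not required when there are infinitely many variables. -/
structure IsMonomialOrder {τ : Type*} (le : (τ →₀ ℕ) → (τ →₀ ℕ) → Prop) : Prop where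
  total : ∀ u v, le u v ∨ le v u
  antisymm : ∀ u v, le u v → le v u → u = v
  trans : ∀ u v w, le u v → le v w → le u w
  zero_le : ∀ u, le 0 u
  add_le_add : ∀ u v w, le u v → le (u + w) (v + w)

/-- The order respects `Inc(ℕ)^i`. -/
def RespectsInc {c : ℕ} (i : ℕ) (le : (InfVar c →₀ ℕ) → (InfVar c →₀ ℕ) → Prop) : Prop :=
  ∀ π ∈ IncMonoid i, ∀ u v : InfVar c →₀ ℕ, le u v →
    le (u.mapDomain (varAct c π)) (v.mapDomain (varAct c π))

/-- Restriction to the monomials of `R_n` of an order on the monomials of `R`. -/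
def restrictOrder {c : ℕ} (le : (InfVar c →₀ ℕ) → (InfVar c →₀ ℕ) → Prop) (n : ℕ)
    (u v : FinVar c n →₀ ℕ) : Prop :=
  le (u.mapDomain (varIncl c n)) (v.mapDomain (varIncl c n))

/-- The initial ideal: generated by the leading monomials of the nonzero elements of `J`. -/
def initialIdeal {K τ : Type*} [Field K] (le : (τ →₀ ℕ) → (τ →₀ ℕ) → Prop)
    (J : Ideal (MvPolynomial τ K)) : Ideal (MvPolynomial τ K) :=
  Ideal.span {x | ∃ f ∈ J, ∃ s ∈ f.support, (∀ t ∈ f.support, le t s) ∧ x = monomial s 1}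

/-- The chain of initial ideals. -/
def initialChain {K : Type*} [Field K] {c : ℕ}
    (le : (InfVar c →₀ ℕ) → (InfVar c →₀ ℕ) → Prop)
    (I : (n : ℕ) → Ideal (MvPolynomial (FinVar c n) K)) :
    (n : ℕ) → Ideal (MvPolynomial (FinVar c n) K) :=
  fun n => initialIdeal (restrictOrder le n) (I n)

/-! ### Weights -/

section Weights

variable {K : Type*} [Field K] {c : ℕ}

/-- Exponents of the minimal monomial generators of a monomial ideal. -/
def minGens {τ : Type*} (J : Ideal (MvPolynomial τ K)) : Set (τ →₀ ℕ) :=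
  {u | monomial u (1 : K) ∈ J ∧ ∀ v : τ →₀ ℕ, monomial v (1 : K) ∈ J → v ≤ u → v = u}

/-- Minimal generators `u ≠ 1` that involve none of the first `i` column indices. -/
def minGensPlus {n : ℕ} (i : ℕ) (J : Ideal (MvPolynomial (FinVar c n) K)) :
    Set (FinVar c n →₀ ℕ) :=
  {u | u ∈ minGens J ∧ u ≠ 0 ∧ ∀ v ∈ u.support, i ≤ ((ofLex v).2 : ℕ)}

/-- `w_k^{(i)}(u)`: the largest exponent in `u` of a variable of row `k` outside the first `i`
columns. -/
def rowWeight {n : ℕ} (i : ℕ) (k : Fin c) (u : FinVar c n →₀ ℕ) : ℕ :=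
  (Finset.univ.filter fun j : Fin n => i ≤ (j : ℕ)).sup fun j => u (toLex (k, j))

/-- `w^{(i)}(u)`. -/
def weight {n : ℕ} (i : ℕ) (u : FinVar c n →₀ ℕ) : ℕ :=
  Finset.univ.sup fun k : Fin c => rowWeight i k u

/-- `w_k^{(i)}(J)`. -/
def idealRowWeight {n : ℕ} (i : ℕ) (k : Fin c) (J : Ideal (MvPolynomial (FinVar c n) K)) : ℕ :=
  sSup (rowWeight i k '' minGens J)

open Classical in
/-- `ω^{(i)}(J)`. -/
def idealOmega {n : ℕ} (i : ℕ) (J : Ideal (MvPolynomial (FinVar c n) K)) : ℕ :=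
  if (minGensPlus i J).Nonempty then sInf (weight i '' minGensPlus i J)
  else sSup (weight i '' minGens J)

/-- The eventual value of an eventually constant sequence. -/
def eventualValue (a : ℕ → ℕ) : ℕ := sInf {v | ∀ᶠ n in atTop, a n = v}

/-- `w_k(𝓘)`: the value for `i ≫ 0` of the value for `n ≫ 0` of `w_k^{(i)}(I_n)`. -/
def chainRowWeight (I : (n : ℕ) → Ideal (MvPolynomial (FinVar c n) K)) (k : Fin c) : ℕ :=
  eventualValue fun i => eventualValue fun n => idealRowWeight i k (I n)

/-- `ω(𝓘)`: the value for `i ≫ 0` of the value for `n ≫ 0` of `ω^{(i)}(I_n)`. -/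
def chainOmega (I : (n : ℕ) → Ideal (MvPolynomial (FinVar c n) K)) : ℕ :=
  eventualValue fun i => eventualValue fun n => idealOmega i (I n)

/-- `C(𝓘) = max{ω(𝓘) - 1, 0} + max_l ∑_{k ≠ l} w_k(𝓘)` (subtraction in `ℕ` is truncated). -/
def chainC (I : (n : ℕ) → Ideal (MvPolynomial (FinVar c n) K)) : ℕ :=
  (chainOmega I - 1) +
    Finset.univ.sup fun l : Fin c => ∑ k ∈ Finset.univ.erase l, chainRowWeight I k

end Weights

end

/-! Compute `Tor` from the Koszul complex and filter it by the monomial order on multidegrees. The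
part of top multidegree `m` of a cycle lives on the upper Koszul complex of `in(I)` in degree `m`.
If some vertex can be coned off the faces in question, the lift of the cone to `I` is a chain whose
boundary cancels this top part; hence `Tor_p(K, I)_q = 0` as soon as every multidegree of degree `q`
has such a cone apex, and it remains to bound the degrees of the multidegrees without one.

A monomial of `R_n` is a word of `n` columns in `ℕ^c`, and by Higman's lemma the minimal generators
of `in(I_n)`, `n ≫ 0`, arise from earlier ones by inserting zero columns. This makes the weights
stabilise, and it yields constants `P` and `N` such that a monomial with `N` columns `≥ (ω, …, ω)`
beyond the `P`-th one lies in `in(I_n)` whenever its first `P` columns dominate those of some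
monomial of `in(I_n)`. Now let `m` have no cone apex in homological degree `p`. Beyond the `P`-th
column its entries in row `k` are at most `w_k`, all but `N + p` columns have an entry `< ω`, and
all but `N` columns have an entry `≤ ω`, because removing a squarefree monomial lowers an entry by
at most one. Adding up the columns gives `deg m ≤ C n + D + p`. -/

noncomputable section

/-! ### Monomial orders -/

namespace IsMonomialOrder

variable {τ : Type*} {le : (τ →₀ ℕ) → (τ →₀ ℕ) → Prop}

theorem refl (h : IsMonomialOrder le) (u : τ →₀ ℕ) : le u u :=
  (h.total u u).elim id id

theorem le_of_add_le_add (h : IsMonomialOrder le) {u v w : τ →₀ ℕ}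
    (huv : le (u + w) (v + w)) : le u v := by
  rcases h.total u v with hle | hge
  · exact hle
  · rw [add_right_cancel (h.antisymm _ _ huv (h.add_le_add _ _ w hge))]
    exact h.refl v

theorem exists_max (h : IsMonomialOrder le) {S : Set (τ →₀ ℕ)} (hfin : S.Finite)
    (hne : S.Nonempty) : ∃ m ∈ S, ∀ u ∈ S, le u m := by
  have := hfin.to_subtype
  have := hne.to_subtype
  have : IsTrans (τ →₀ ℕ) le := ⟨h.trans⟩
  have hdir : Directed le ((↑) : S → τ →₀ ℕ) := fun u v =>
    (h.total u v).elim (fun huv => ⟨v, huv, h.refl _⟩) fun hvu => ⟨u, h.refl _, hvu⟩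
  obtain ⟨m, hm⟩ := hdir.finite_le id
  exact ⟨m, m.2, fun u hu => hm ⟨u, hu⟩⟩

theorem wellFoundedOn_degree_eq [Finite τ] (h : IsMonomialOrder le) (q : ℕ) :
    {m : τ →₀ ℕ | m.degree = q}.WellFoundedOn fun u v => le u v ∧ u ≠ v := by
  have : IsStrictOrder (τ →₀ ℕ) fun u v => le u v ∧ u ≠ v :=
    { irrefl := fun _ hu => hu.2 rfl
      trans := fun u v w huv hvw => ⟨h.trans u v w huv.1 hvw.1, by
        rintro rfl
        exact huv.2 (h.antisymm _ _ huv.1 hvw.1)⟩ }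
  exact ((Finsupp.finite_of_degree_le q).subset fun _ hm => le_of_eq hm).wellFoundedOn

end IsMonomialOrder

section InitialIdeal

variable {K τ : Type*} [Field K] {le : (τ →₀ ℕ) → (τ →₀ ℕ) → Prop}

theorem monomial_mem_initialIdeal_iff (h : IsMonomialOrder le) {J : Ideal (MvPolynomial τ K)}
    {u : τ →₀ ℕ} : monomial u (1 : K) ∈ initialIdeal le J ↔
      ∃ f ∈ J, u ∈ f.support ∧ ∀ t ∈ f.support, le t u := by
  classical
  refine ⟨fun hu => ?_, fun ⟨f, hf, hu, hmax⟩ => Ideal.subset_span ⟨f, hf, u, hu, hmax, rfl⟩⟩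
  have hgen : {x | ∃ f ∈ J, ∃ s ∈ f.support, (∀ t ∈ f.support, le t s) ∧
      x = monomial s (1 : K)} = (fun s => monomial s (1 : K)) ''
        {s | ∃ f ∈ J, s ∈ f.support ∧ ∀ t ∈ f.support, le t s} := by
    ext x
    constructor
    · rintro ⟨f, hf, s, hs, hmax, rfl⟩
      exact ⟨s, ⟨f, hf, hs, hmax⟩, rfl⟩
    · rintro ⟨s, ⟨f, hf, hs, hmax⟩, rfl⟩
      exact ⟨f, hf, s, hs, hmax, rfl⟩
  rw [initialIdeal, hgen, mem_ideal_span_monomial_image] at hu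
  obtain ⟨s, ⟨f, hf, hs, hmax⟩, hsu⟩ := hu u (by simp)
  obtain ⟨d, rfl⟩ := exists_add_of_le hsu
  refine ⟨monomial d 1 * f, J.mul_mem_left _ hf, ?_, fun t ht => ?_⟩
  · rw [mem_support_iff, add_comm, coeff_monomial_mul, one_mul]
    exact mem_support_iff.1 hs
  · rw [mem_support_iff, coeff_monomial_mul', one_mul] at ht
    obtain ⟨hd, hcoeff⟩ := ite_ne_right_iff.1 ht
    simpa only [tsub_add_cancel_of_le hd]
      using h.add_le_add _ _ d (hmax (t - d) (mem_support_iff.2 hcoeff))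

theorem exists_homogeneous_lift (h : IsMonomialOrder le) {J : Ideal (MvPolynomial τ K)}
    (hJ : IsGradedIdeal J) {u : τ →₀ ℕ} (hu : monomial u (1 : K) ∈ initialIdeal le J) :
    ∃ f ∈ J, coeff u f = 1 ∧ ∀ t ∈ f.support, le t u ∧ t.degree = u.degree := by
  obtain ⟨f, hf, huf, hmax⟩ := (monomial_mem_initialIdeal_iff h).1 hu
  rw [mem_support_iff] at huf
  refine ⟨C (coeff u f)⁻¹ * homogeneousComponent u.degree f,
    J.mul_mem_left _ (hJ f hf _), ?_, fun t ht => ?_⟩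
  · rw [coeff_C_mul, coeff_homogeneousComponent, if_pos rfl, inv_mul_cancel₀ huf]
  · rw [mem_support_iff, coeff_C_mul, coeff_homogeneousComponent] at ht
    obtain ⟨hdeg, hcoeff⟩ := ite_ne_right_iff.1 (right_ne_zero_of_mul ht)
    exact ⟨hmax t (mem_support_iff.2 hcoeff), hdeg⟩

end InitialIdeal

/-! ### Leading parts of Koszul chains -/

/-- The exponent vector of the squarefree monomial with support `A`. -/
def finsetExponent {σ : Type*} (A : Finset σ) : σ →₀ ℕ := ∑ a ∈ A, Finsupp.single a 1

section Multidegree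

variable {K σ : Type*} [Field K]

theorem finsetExponent_apply [DecidableEq σ] (A : Finset σ) (x : σ) :
    finsetExponent A x = if x ∈ A then 1 else 0 := by
  simp [finsetExponent, Finsupp.finsetSum_apply, Finsupp.single_apply]

theorem finsetExponent_insert [DecidableEq σ] {A : Finset σ} {v : σ} (h : v ∉ A) :
    finsetExponent (insert v A) = Finsupp.single v 1 + finsetExponent A :=
  Finset.sum_insert h

theorem degree_finsetExponent (A : Finset σ) : (finsetExponent A).degree = A.card := by
  simp [finsetExponent]

/-- The part of multidegree `m` of a Koszul chain `f`, as the family of the coefficients of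
`x ^ (m - finsetExponent A) e_A`; it is zero at the `A` for which this is not a monomial. -/
def multidegreePart (m : σ →₀ ℕ) : (Finset σ → MvPolynomial σ K) →ₗ[K] (Finset σ → K) where
  toFun f A := if finsetExponent A ≤ m then coeff (m - finsetExponent A) (f A) else 0
  map_add' f g := by
    funext A
    by_cases h : finsetExponent A ≤ m <;> simp [h]
  map_smul' r f := by
    funext A
    by_cases h : finsetExponent A ≤ m <;> simp [h]

theorem multidegreePart_apply (m : σ →₀ ℕ) (f : Finset σ → MvPolynomial σ K) (A : Finset σ) :
    multidegreePart m f A =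
      if finsetExponent A ≤ m then coeff (m - finsetExponent A) (f A) else 0 :=
  rfl

theorem multidegreePart_add_finsetExponent (u : σ →₀ ℕ) (f : Finset σ → MvPolynomial σ K)
    (A : Finset σ) : multidegreePart (u + finsetExponent A) f A = coeff u (f A) := by
  simp [multidegreePart_apply]

theorem multidegreePart_ne_zero_iff {m : σ →₀ ℕ} {f : Finset σ → MvPolynomial σ K}
    {A : Finset σ} :
    multidegreePart m f A ≠ 0 ↔ ∃ u, u + finsetExponent A = m ∧ coeff u (f A) ≠ 0 := by
  constructor
  · intro h
    obtain ⟨hA, hcoeff⟩ := ite_ne_right_iff.1 h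
    exact ⟨_, tsub_add_cancel_of_le hA, hcoeff⟩
  · rintro ⟨u, rfl, hu⟩
    rwa [multidegreePart_add_finsetExponent]

/-- Every multidegree occurring in the Koszul chain `f` is at most `m` in the order `le`. -/
def MultidegreeLE (le : (σ →₀ ℕ) → (σ →₀ ℕ) → Prop) (f : Finset σ → MvPolynomial σ K)
    (m : σ →₀ ℕ) : Prop :=
  ∀ t A, multidegreePart t f A ≠ 0 → le t m

theorem MultidegreeLE.sub {le : (σ →₀ ℕ) → (σ →₀ ℕ) → Prop}
    {f g : Finset σ → MvPolynomial σ K} {m : σ →₀ ℕ} (hf : MultidegreeLE le f m)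
    (hg : MultidegreeLE le g m) : MultidegreeLE le (f - g) m := by
  intro t A hne
  by_cases hfA : multidegreePart t f A = 0
  · refine hg t A fun hgA => hne ?_
    rw [map_sub, Pi.sub_apply, hfA, hgA, sub_zero]
  · exact hf t A hfA

/-- The upper Koszul simplicial complex of the monomial ideal `J` in multidegree `m`: the faces
are the sets `A` such that `x ^ m` divided by the squarefree monomial of `A` lies in `J`. -/
def upperKoszulComplex (J : Ideal (MvPolynomial σ K)) (m : σ →₀ ℕ) : Set (Finset σ) :=
  {A | ∃ u, u + finsetExponent A = m ∧ monomial u (1 : K) ∈ J}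

/-- Some vertex `v` can be coned off all faces with `p` elements of the upper Koszul complex of
`J` in multidegree `m`; the cone then kills the homology on these faces. -/
def HasConeApex [DecidableEq σ] (J : Ideal (MvPolynomial σ K)) (p : ℕ) (m : σ →₀ ℕ) : Prop :=
  ∃ v, ∀ A ∈ upperKoszulComplex J m, A.card = p → insert v A ∈ upperKoszulComplex J m

theorem mem_upperKoszulComplex_initialIdeal {le : (σ →₀ ℕ) → (σ →₀ ℕ) → Prop}
    (hle : IsMonomialOrder le) {I : Ideal (MvPolynomial σ K)} {m : σ →₀ ℕ}
    {f : Finset σ → MvPolynomial σ K} (hfm : MultidegreeLE le f m) {A : Finset σ}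
    (hfA : f A ∈ I) (hne : multidegreePart m f A ≠ 0) :
    A ∈ upperKoszulComplex (initialIdeal le I) m := by
  obtain ⟨u, rfl, hu⟩ := multidegreePart_ne_zero_iff.1 hne
  refine ⟨u, rfl, (monomial_mem_initialIdeal_iff hle).2
    ⟨f A, hfA, mem_support_iff.2 hu, fun t ht => ?_⟩⟩
  exact hle.le_of_add_le_add (hfm (t + finsetExponent A) A
    (multidegreePart_ne_zero_iff.2 ⟨t, rfl, mem_support_iff.1 ht⟩))

end Multidegree

section Koszul

variable {K σ : Type*} [Field K] [LinearOrder σ]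

theorem mem_koszulChains_iff {I : Ideal (MvPolynomial σ K)} {p j : ℕ}
    {f : Finset σ → MvPolynomial σ K} :
    f ∈ koszulChains I p j ↔
      (∀ A, f A ∈ I) ∧ ∀ m A, multidegreePart m f A ≠ 0 → A.card = p ∧ m.degree = j := by
  constructor
  · refine fun hf => ⟨fun A => (hf A).1, fun m A hne => ?_⟩
    obtain ⟨u, rfl, hu⟩ := multidegreePart_ne_zero_iff.1 hne
    have hcard : A.card = p := (hf A).2.1 fun h0 => hu (by rw [h0, coeff_zero])
    rw [map_add, degree_finsetExponent, hcard]
    exact ⟨rfl, (hf A).2.2 u (mem_support_iff.2 hu)⟩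
  · rintro ⟨hI, hdeg⟩ A
    have hsupp (u : σ →₀ ℕ) (hu : u ∈ (f A).support) : A.card = p ∧ u.degree + p = j := by
      obtain ⟨rfl, rfl⟩ := hdeg (u + finsetExponent A) A
        (multidegreePart_ne_zero_iff.2 ⟨u, rfl, mem_support_iff.1 hu⟩)
      rw [map_add, degree_finsetExponent]
      exact ⟨rfl, rfl⟩
    refine ⟨hI A, fun hne => ?_, fun u hu => (hsupp u hu).2⟩
    obtain ⟨u, hu⟩ := support_nonempty.2 hne
    exact (hsupp u hu).1

theorem exists_koszulChain_multidegreePart_eq {le : (σ →₀ ℕ) → (σ →₀ ℕ) → Prop}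
    (hle : IsMonomialOrder le) {I : Ideal (MvPolynomial σ K)} (hI : IsGradedIdeal I) {p : ℕ}
    {m : σ →₀ ℕ} {c : Finset σ → K}
    (hc : ∀ B, c B ≠ 0 → B.card = p ∧ B ∈ upperKoszulComplex (initialIdeal le I) m) :
    ∃ g ∈ koszulChains I p m.degree, MultidegreeLE le g m ∧ multidegreePart m g = c := by
  have hlift (B : Finset σ) : ∃ h ∈ I, c B ≠ 0 → B.card = p ∧ ∃ u, u + finsetExponent B = m ∧
      coeff u h = 1 ∧ ∀ t ∈ h.support, le t u ∧ t.degree = u.degree := by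
    by_cases hB : c B = 0
    · exact ⟨0, I.zero_mem, fun hne => absurd hB hne⟩
    · obtain ⟨hcard, u, hu, huI⟩ := hc B hB
      obtain ⟨h, hhI, hh⟩ := exists_homogeneous_lift hle hI huI
      exact ⟨h, hhI, fun _ => ⟨hcard, u, hu, hh⟩⟩
  choose h hhI hh using hlift
  set g : Finset σ → MvPolynomial σ K := fun B => C (c B) * h B with hg
  have hterm (t : σ →₀ ℕ) (B : Finset σ) (hne : multidegreePart t g B ≠ 0) :
      le t m ∧ B.card = p ∧ t.degree = m.degree := by
    obtain ⟨s, rfl, hs⟩ := multidegreePart_ne_zero_iff.1 hne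
    rw [hg, coeff_C_mul] at hs
    obtain ⟨hcard, u, rfl, -, hsupp⟩ := hh B (left_ne_zero_of_mul hs)
    obtain ⟨hsu, hdeg⟩ := hsupp s (mem_support_iff.2 (right_ne_zero_of_mul hs))
    exact ⟨hle.add_le_add _ _ _ hsu, hcard, by rw [map_add, map_add, hdeg]⟩
  refine ⟨g, mem_koszulChains_iff.2 ⟨fun B => I.mul_mem_left _ (hhI B), fun t B hne =>
    (hterm t B hne).2⟩, fun t B hne => (hterm t B hne).1, funext fun B => ?_⟩
  by_cases hB : c B = 0
  · simp [multidegreePart_apply, hg, hB]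
  · obtain ⟨-, u, rfl, hone, -⟩ := hh B hB
    rw [multidegreePart_add_finsetExponent, hg, coeff_C_mul, hone, mul_one]

/-- The cone operator with apex `v`, with the sign that makes it a contracting homotopy of
`subsetBoundary` below. -/
def coneOperator (v : σ) (c : Finset σ → K) (B : Finset σ) : K :=
  if v ∈ B then (-1) ^ ((B.erase v).filter (· < v)).card * c (B.erase v) else 0

theorem coneOperator_insert {v : σ} {E : Finset σ} (hv : v ∉ E) (c : Finset σ → K) :
    coneOperator v c (insert v E) = (-1) ^ (E.filter (· < v)).card * c E := by
  rw [coneOperator, if_pos (E.mem_insert_self v), Finset.erase_insert hv]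

theorem sign_mul_sign_mul (k : ℕ) (x : K) : (-1) ^ k * ((-1) ^ k * x) = x := by
  rw [← mul_assoc, ← mul_pow, neg_one_mul, neg_neg, one_pow, one_mul]

theorem exists_leading_multidegree [Finite σ] {le : (σ →₀ ℕ) → (σ →₀ ℕ) → Prop}
    (hle : IsMonomialOrder le) {I : Ideal (MvPolynomial σ K)} {p j : ℕ}
    {f : Finset σ → MvPolynomial σ K} (hf : f ∈ koszulChains I p j) (hne : f ≠ 0) :
    ∃ m, m.degree = j ∧ multidegreePart m f ≠ 0 ∧ MultidegreeLE le f m := by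
  have hdeg := (mem_koszulChains_iff.1 hf).2
  obtain ⟨A, hA⟩ := Function.ne_iff.1 hne
  obtain ⟨u, hu⟩ := ne_zero_iff.1 hA
  obtain ⟨m, ⟨B, hB⟩, hmax⟩ := hle.exists_max
    (S := {m | ∃ A, multidegreePart m f A ≠ 0})
    ((Finsupp.finite_of_degree_le j).subset fun m ⟨A, hA⟩ => (hdeg m A hA).2.le)
    ⟨_, A, multidegreePart_ne_zero_iff.2 ⟨u, rfl, hu⟩⟩
  exact ⟨m, (hdeg m B hB).2, Function.ne_iff.2 ⟨B, hB⟩, fun t A hA => hmax t ⟨A, hA⟩⟩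

variable [Fintype σ]

/-- The simplicial boundary on functions on the subsets of `σ`. -/
def subsetBoundary (c : Finset σ → K) (B : Finset σ) : K :=
  ∑ v ∈ Finset.univ \ B, (-1) ^ (B.filter (· < v)).card * c (insert v B)

theorem multidegreePart_koszulD (m : σ →₀ ℕ) (f : Finset σ → MvPolynomial σ K) :
    multidegreePart m (koszulD f) = subsetBoundary (multidegreePart m f) := by
  have coeff_sign_mul (k : ℕ) (u : σ →₀ ℕ) (g : MvPolynomial σ K) :
      coeff u ((-1) ^ k * g) = (-1) ^ k * coeff u g := by
    rw [← coeff_C_mul, map_pow, map_neg, map_one]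
  funext B
  by_cases hB : finsetExponent B ≤ m
  · rw [multidegreePart_apply, if_pos hB, subsetBoundary]
    simp only [koszulD, LinearMap.coe_mk, AddHom.coe_mk, coeff_sum, coeff_sign_mul]
    refine Finset.sum_congr rfl fun v hv => ?_
    have hvB : v ∉ B := (Finset.mem_sdiff.1 hv).2
    have hmem : v ∈ (m - finsetExponent B).support ↔
        Finsupp.single v 1 + finsetExponent B ≤ m := by
      rw [← le_tsub_iff_right hB, Finsupp.single_le_iff, Finsupp.mem_support_iff,
        Nat.one_le_iff_ne_zero]
    rw [coeff_X_mul', multidegreePart_apply, finsetExponent_insert hvB, tsub_tsub,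
      add_comm (finsetExponent B)]
    simp only [hmem]
  · rw [multidegreePart_apply, if_neg hB, subsetBoundary]
    refine (Finset.sum_eq_zero fun v hv => ?_).symm
    rw [multidegreePart_apply, finsetExponent_insert (Finset.mem_sdiff.1 hv).2,
      if_neg fun h => hB (le_add_self.trans h), mul_zero]

theorem exists_multidegreePart_insert_ne_zero {m : σ →₀ ℕ} {f : Finset σ → MvPolynomial σ K}
    {B : Finset σ} (h : multidegreePart m (koszulD f) B ≠ 0) :
    ∃ v ∉ B, multidegreePart m f (insert v B) ≠ 0 := by
  rw [multidegreePart_koszulD] at h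
  obtain ⟨v, hv, hne⟩ := Finset.exists_ne_zero_of_sum_ne_zero h
  exact ⟨v, (Finset.mem_sdiff.1 hv).2, right_ne_zero_of_mul hne⟩

theorem MultidegreeLE.koszulD {le : (σ →₀ ℕ) → (σ →₀ ℕ) → Prop}
    {f : Finset σ → MvPolynomial σ K} {m : σ →₀ ℕ} (hf : MultidegreeLE le f m) :
    MultidegreeLE le (koszulD f) m := fun t _ hne =>
  let ⟨_, _, hv⟩ := exists_multidegreePart_insert_ne_zero hne
  hf t _ hv

theorem koszulD_mem_koszulChains {I : Ideal (MvPolynomial σ K)} {p j : ℕ}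
    {f : Finset σ → MvPolynomial σ K} (hf : f ∈ koszulChains I (p + 1) j) :
    koszulD f ∈ koszulChains I p j := by
  rw [mem_koszulChains_iff] at hf ⊢
  refine ⟨fun B => I.sum_mem fun v _ => I.mul_mem_left _ (I.mul_mem_left _ (hf.1 _)),
    fun m B hne => ?_⟩
  obtain ⟨v, hv, hne⟩ := exists_multidegreePart_insert_ne_zero hne
  have := hf.2 m _ hne
  rwa [Finset.card_insert_of_notMem hv, Nat.add_right_cancel_iff] at this

theorem subsetBoundary_coneOperator_insert {v : σ} {E : Finset σ} (hv : v ∉ E)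
    (c : Finset σ → K) :
    subsetBoundary (coneOperator v c) (insert v E) =
      c (insert v E) - (-1) ^ (E.filter (· < v)).card * subsetBoundary c E := by
  have hsplit : (Finset.univ \ E : Finset σ) = insert v (Finset.univ \ insert v E) := by
    ext x
    by_cases hx : x = v <;> simp [hx, hv]
  rw [subsetBoundary, subsetBoundary, hsplit, Finset.sum_insert (by simp), mul_add,
    sign_mul_sign_mul, sub_add_cancel_left, Finset.mul_sum, ← Finset.sum_neg_distrib]
  refine Finset.sum_congr rfl fun w hw => ?_
  obtain ⟨hwv, hwE⟩ : w ≠ v ∧ w ∉ E := by simpa using hw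
  rw [Finset.insert_comm, coneOperator_insert (by simp [hv, hwv.symm])]
  simp only [Finset.filter_insert]
  rcases lt_or_gt_of_ne hwv with hlt | hgt
  · rw [if_neg hlt.not_gt, if_pos hlt, Finset.card_insert_of_notMem (by simp [hwE])]
    ring
  · rw [if_pos hgt, if_neg hgt.not_gt, Finset.card_insert_of_notMem (by simp [hv])]
    ring

theorem subsetBoundary_coneOperator (v : σ) {c : Finset σ → K} (hc : subsetBoundary c = 0) :
    subsetBoundary (coneOperator v c) = c := by
  funext B
  by_cases hB : v ∈ B
  · have h := subsetBoundary_coneOperator_insert (B.notMem_erase v) c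
    rwa [Finset.insert_erase hB, hc, Pi.zero_apply, mul_zero, sub_zero] at h
  · rw [subsetBoundary, Finset.sum_eq_single_of_mem v (by simp [hB]), coneOperator_insert hB,
      sign_mul_sign_mul]
    intro w _ hwv
    rw [coneOperator, if_neg (by simp [hB, hwv.symm]), mul_zero]

theorem exists_koszulD_multidegreePart_eq {le : (σ →₀ ℕ) → (σ →₀ ℕ) → Prop}
    (hle : IsMonomialOrder le) {I : Ideal (MvPolynomial σ K)} (hI : IsGradedIdeal I) {p : ℕ}
    {m : σ →₀ ℕ} (hcone : HasConeApex (initialIdeal le I) p m)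
    {f : Finset σ → MvPolynomial σ K} (hf : f ∈ koszulCycles I p m.degree)
    (hfm : MultidegreeLE le f m) :
    ∃ g ∈ koszulChains I (p + 1) m.degree,
      MultidegreeLE le g m ∧ multidegreePart m (koszulD g) = multidegreePart m f := by
  obtain ⟨v, hv⟩ := hcone
  obtain ⟨hfI, hfp⟩ := mem_koszulChains_iff.1 hf.1
  have hcycle : subsetBoundary (multidegreePart m f) = 0 := by
    rw [← multidegreePart_koszulD, LinearMap.mem_ker.1 hf.2, map_zero]
  obtain ⟨g, hg, hgm, hgpart⟩ := exists_koszulChain_multidegreePart_eq hle hI (p := p + 1)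
    (m := m) (c := coneOperator v (multidegreePart m f)) fun B hB => by
      obtain ⟨hvB, hne⟩ := ite_ne_right_iff.1 hB
      replace hne := right_ne_zero_of_mul hne
      have hcard := (hfp m _ hne).1
      have hface := hv _ (mem_upperKoszulComplex_initialIdeal hle hfm (hfI _) hne) hcard
      rw [Finset.insert_erase hvB] at hface
      exact ⟨by rw [← hcard, Finset.card_erase_add_one hvB], hface⟩
  refine ⟨g, hg, hgm, ?_⟩
  rw [multidegreePart_koszulD, hgpart, subsetBoundary_coneOperator v hcycle]

theorem mem_koszulBoundaries_of_multidegreeLE {le : (σ →₀ ℕ) → (σ →₀ ℕ) → Prop}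
    (hle : IsMonomialOrder le) {I : Ideal (MvPolynomial σ K)} (hI : IsGradedIdeal I) {p q : ℕ}
    (hcone : ∀ m : σ →₀ ℕ, m.degree = q → HasConeApex (initialIdeal le I) p m)
    {m : σ →₀ ℕ} (hm : m.degree = q) {f : Finset σ → MvPolynomial σ K}
    (hf : f ∈ koszulCycles I p q) (hfm : MultidegreeLE le f m) :
    f ∈ koszulBoundaries I p q := by
  refine (hle.wellFoundedOn_degree_eq q).induction
    (P := fun m => ∀ f ∈ koszulCycles I p q, MultidegreeLE le f m → f ∈ koszulBoundaries I p q)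
    hm ?_ f hf hfm
  rintro m rfl ih f hf hfm
  obtain ⟨g, hg, hgm, hgf⟩ := exists_koszulD_multidegreePart_eq hle hI (hcone m rfl) hf hfm
  have hgD : koszulD g ∈ koszulBoundaries I p m.degree := Submodule.mem_map_of_mem hg
  have hsub : f - koszulD g ∈ koszulCycles I p m.degree :=
    sub_mem hf ⟨koszulD_mem_koszulChains hg, koszulD_comp g⟩
  suffices hmem : f - koszulD g ∈ koszulBoundaries I p m.degree by
    simpa only [sub_add_cancel] using add_mem hmem hgD
  by_cases h0 : f - koszulD g = 0
  · rw [h0]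
    exact zero_mem _
  · obtain ⟨t, ht, hne, htop⟩ := exists_leading_multidegree hle hsub.1 h0
    obtain ⟨A, hA⟩ := Function.ne_iff.1 hne
    refine ih t ht ⟨hfm.sub hgm.koszulD t A hA, ?_⟩ _ hsub htop
    rintro rfl
    exact hne (by rw [map_sub, hgf, sub_self])

theorem koszulCycles_le_koszulBoundaries {le : (σ →₀ ℕ) → (σ →₀ ℕ) → Prop}
    (hle : IsMonomialOrder le) {I : Ideal (MvPolynomial σ K)} (hI : IsGradedIdeal I) {p q : ℕ}
    (hcone : ∀ m : σ →₀ ℕ, m.degree = q → HasConeApex (initialIdeal le I) p m) :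
    koszulCycles I p q ≤ koszulBoundaries I p q := by
  intro f hf
  by_cases h0 : f = 0
  · rw [h0]
    exact zero_mem _
  · obtain ⟨m, hm, -, hfm⟩ := exists_leading_multidegree hle hf.1 h0
    exact mem_koszulBoundaries_of_multidegreeLE hle hI hcone hm hf hfm

theorem regularity_le {le : (σ →₀ ℕ) → (σ →₀ ℕ) → Prop} (hle : IsMonomialOrder le)
    {I : Ideal (MvPolynomial σ K)} (hI : IsGradedIdeal I) {r : ℕ}
    (hcone : ∀ (p : ℕ) (m : σ →₀ ℕ), r + p < m.degree → HasConeApex (initialIdeal le I) p m) :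
    regularity I ≤ ((r : ℝ) : EReal) := by
  refine sSup_le ?_
  rintro _ ⟨p, q, htor, rfl⟩
  suffices h : q ≤ r + p by
    rw [EReal.coe_le_coe_iff, sub_le_iff_le_add]
    exact_mod_cast h
  contrapose! htor
  have hexact := koszulCycles_le_koszulBoundaries hle hI (p := p) (q := q)
    fun m hm => hcone p m (by rwa [hm])
  rw [gradedTor, Submodule.submoduleOf_eq_top.2 hexact]
  infer_instance

end Koszul

/-! ### Families of column sequences closed under increasing maps -/

theorem exists_orderEmbedding_of_wellQuasiOrdered {β : Type*} {r : β → β → Prop} [IsPreorder β r]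
    (hr : WellQuasiOrdered r) {L : ℕ → ℕ} (v : ∀ k, Fin (L k) → β) :
    ∃ a b, a < b ∧ ∃ π : Fin (L a) ↪o Fin (L b), ∀ j, r (v a j) (v b (π j)) := by
  have higman := Set.PartiallyWellOrderedOn.partiallyWellOrderedOn_sublistForall₂ r
    (Set.partiallyWellOrderedOn_univ_iff.2 hr)
  obtain ⟨a, b, hab, hsub⟩ := higman (fun k => ⟨List.ofFn (v k), fun _ _ => Set.mem_univ _⟩)
  obtain ⟨l, hl, hlb⟩ := List.sublistForall₂_iff.1 hsub
  obtain ⟨hlen, hget⟩ := List.forall₂_iff_get.1 hl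
  obtain ⟨f, hf⟩ := List.sublist_iff_exists_fin_orderEmbedding_get_eq.1 hlb
  have ha : L a = l.length := by rw [← hlen, List.length_ofFn]
  refine ⟨a, b, hab, ((Fin.castOrderIso ha).toOrderEmbedding.trans f).trans
    (Fin.castOrderIso List.length_ofFn).toOrderEmbedding, fun j => ?_⟩
  have hj := hget j (by simp) (ha ▸ j.2)
  have hfj := hf ⟨j, ha ▸ j.2⟩
  rw [hfj] at hj
  simp only [List.get_ofFn] at hj
  exact hj

theorem exists_orderEmbedding_fixing_prefix {α : Type*} [Preorder α] [WellQuasiOrderedLE α]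
    (p : ℕ) {L : ℕ → ℕ} (v : ∀ k, Fin (L k) → α) :
    ∃ a b, a < b ∧ ∃ π : Fin (L a) ↪o Fin (L b),
      (∀ j : Fin (L a), (j : ℕ) < p → (π j : ℕ) = j) ∧ ∀ j, v a j ≤ v b (π j) := by
  have : IsPreorder (α × Fin (p + 1)) fun x y => x.1 ≤ y.1 ∧ x.2 = y.2 :=
    { refl := fun _ => ⟨le_rfl, rfl⟩
      trans := fun _ _ _ hxy hyz => ⟨hxy.1.trans hyz.1, hxy.2.trans hyz.2⟩ }
  -- Labelling the column `j` by `min j p` forces the embedding to fix the first `p` columns.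
  obtain ⟨a, b, hab, π, hπ⟩ := exists_orderEmbedding_of_wellQuasiOrdered
    ((wellQuasiOrdered_le (α := α)).prod (Finite.wellQuasiOrdered (α := Fin (p + 1)) Eq))
    fun k j => (v k j, (⟨min j p, Nat.lt_succ_of_le (min_le_right _ _)⟩ : Fin (p + 1)))
  refine ⟨a, b, hab, π, fun j hj => ?_, fun j => (hπ j).1⟩
  have hlabel := congrArg Fin.val (hπ j).2
  dsimp only at hlabel
  omega

theorem exists_orderEmbedding_succAbove {m n : ℕ} (π : Fin m ↪o Fin (n + 1)) {d : Fin (n + 1)}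
    (hd : d ∉ Set.range π) : ∃ π' : Fin m ↪o Fin n, ∀ j, d.succAbove (π' j) = π j := by
  choose π' hπ' using fun j => Fin.exists_succAbove_eq fun h : π j = d => hd ⟨j, h⟩
  refine ⟨OrderEmbedding.ofStrictMono π' fun j k hjk => ?_, hπ'⟩
  rw [← d.succAbove_lt_succAbove_iff, hπ', hπ']
  exact π.strictMono hjk

/-- The combinatorial counterpart of an `Inc(ℕ)^i`-invariant chain of monomial ideals: `M n` is a
set of words of length `n`, and spreading out a word of `M m` by an increasing map that fixes the
first `i` positions, then filling in and increasing letters arbitrarily, gives words of `M n`.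
As for chains of ideals, `M 0` plays no role. -/
def IsIncClosed {α : Type*} [LE α] (i : ℕ) (M : (n : ℕ) → Set (Fin n → α)) : Prop :=
  ∀ m n, 1 ≤ m → ∀ π : Fin m ↪o Fin n, (∀ j : Fin m, (j : ℕ) < i → (π j : ℕ) = j) →
    ∀ u ∈ M m, ∀ v : Fin n → α, (∀ j, u j ≤ v (π j)) → v ∈ M n

namespace IsIncClosed

variable {α : Type*} {i p : ℕ} {M : (n : ℕ) → Set (Fin n → α)}

theorem mem_of_le_card [LE α] (hM : IsIncClosed i M) (hip : i ≤ p) {m n : ℕ} (hm : 1 ≤ m)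
    {u : Fin m → α} (hu : u ∈ M m) {v : Fin n → α} {T : Finset (Fin n)} (hmT : m ≤ T.card)
    (hpT : ∀ l ∈ T, p ≤ (l : ℕ)) (hprefix : ∀ j (hj : j < m) (hj' : j < n), j < p →
      u ⟨j, hj⟩ ≤ v ⟨j, hj'⟩) (hT : ∀ j : Fin m, p ≤ (j : ℕ) → ∀ l ∈ T, u j ≤ v l) : v ∈ M n := by
  have hmn : m ≤ n := hmT.trans (T.card_le_univ.trans_eq (Fintype.card_fin n))
  let π (j : Fin m) : Fin n := if (j : ℕ) < p then j.castLE hmn else T.orderEmbOfCardLe hmT j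
  have hπ_lt {j : Fin m} (hj : (j : ℕ) < p) : π j = j.castLE hmn := if_pos hj
  have hπ_ge {j : Fin m} (hj : ¬ (j : ℕ) < p) : π j = T.orderEmbOfCardLe hmT j := if_neg hj
  have hmem (j : Fin m) : T.orderEmbOfCardLe hmT j ∈ T := T.orderEmbOfCardLe_mem hmT j
  have hmono : StrictMono π := by
    intro j k hjk
    by_cases hk : (k : ℕ) < p
    · rwa [hπ_lt hk, hπ_lt (Fin.lt_def.1 hjk |>.trans hk), Fin.castLE_lt_castLE_iff]
    · rw [hπ_ge hk]
      by_cases hj : (j : ℕ) < p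
      · rw [hπ_lt hj, Fin.lt_def, Fin.val_castLE]
        exact hj.trans_le (hpT _ (hmem k))
      · rw [hπ_ge hj]
        exact (T.orderEmbOfCardLe hmT).strictMono hjk
  refine hM m n hm (OrderEmbedding.ofStrictMono π hmono) (fun j hj => ?_) u hu v fun j => ?_
  · exact congrArg Fin.val (hπ_lt (hj.trans_le hip))
  · change u j ≤ v (π j)
    by_cases hj : (j : ℕ) < p
    · rw [hπ_lt hj]
      exact hprefix j j.2 _ hj
    · rw [hπ_ge hj]
      exact hT j (not_lt.1 hj) _ (hmem j)

theorem insertNth_mem [Preorder α] (hM : IsIncClosed i M) {n : ℕ} (hn : 1 ≤ n) {d : Fin (n + 1)}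
    (hd : i ≤ (d : ℕ)) {u : Fin n → α} (hu : u ∈ M n) (a : α) :
    d.insertNth (α := fun _ => α) a u ∈ M (n + 1) := by
  refine hM n (n + 1) hn d.succAboveOrderEmb (fun j hj => ?_) u hu _ fun j => ?_
  · rw [Fin.succAboveOrderEmb_apply, Fin.succAbove_of_castSucc_lt _ _ (hj.trans_le hd),
      Fin.val_castSucc]
  · rw [Fin.succAboveOrderEmb_apply, Fin.insertNth_apply_succAbove]

theorem eventually_exists_removeNth_mem [Preorder α] [WellQuasiOrderedLE α]
    (hM : IsIncClosed i M) (hip : i ≤ p) :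
    ∀ᶠ n in atTop, ∀ v ∈ M (n + 1), ∃ d : Fin (n + 1), p ≤ (d : ℕ) ∧ d.removeNth v ∈ M n := by
  by_contra hcon
  obtain ⟨φ, hφ, hbad⟩ := extraction_of_frequently_atTop
    ((not_eventually.1 hcon).and_eventually (eventually_ge_atTop p))
  simp only [not_forall, not_exists, not_and] at hbad
  choose v hv hskip using fun k => (hbad k).1
  obtain ⟨a, b, hab, π, hprefix, hle⟩ := exists_orderEmbedding_fixing_prefix p v
  obtain ⟨d, hd⟩ : ∃ d, d ∉ Set.range π := by
    by_contra! hsurj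
    have hcard := Fintype.card_le_of_surjective π hsurj
    rw [Fintype.card_fin, Fintype.card_fin] at hcard
    exact absurd (hφ hab) (by omega)
  have hpd : p ≤ (d : ℕ) := by
    by_contra! hdp
    have hda : (d : ℕ) < φ a + 1 := hdp.trans_le ((hbad a).2.trans (Nat.le_succ _))
    exact hd ⟨⟨d, hda⟩, Fin.ext (hprefix _ hdp)⟩
  obtain ⟨π', hπ'⟩ := exists_orderEmbedding_succAbove π hd
  refine hskip b d hpd (hM _ _ (Nat.le_add_left 1 _) π' (fun j hj => ?_) _ (hv a) _ fun j => ?_)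
  · have hj' : (d.succAbove (π' j) : ℕ) = j := by rw [hπ', hprefix j (hj.trans_le hip)]
    rw [Fin.succAbove] at hj'
    split_ifs at hj' with hlt
    · exact hj'
    · rw [Fin.val_succ] at hj'
      rw [Fin.lt_def, Fin.val_castSucc] at hlt
      omega
  · rw [Fin.removeNth_apply, hπ']
    exact hle j

theorem eventually_exists_eq_on_prefix [Preorder α] [WellQuasiOrderedLE α]
    (hM : IsIncClosed i M) (hip : i ≤ p) :
    ∀ᶠ N in atTop, ∀ n (h : N ≤ n), ∀ v ∈ M n,
      ∃ v' ∈ M N, ∀ j : Fin N, (j : ℕ) < p → v' j = v (j.castLE h) := by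
  obtain ⟨n₀, hskip⟩ := eventually_atTop.1 (hM.eventually_exists_removeNth_mem hip)
  filter_upwards [eventually_ge_atTop n₀] with N hN n h
  induction n, h using Nat.le_induction with
  | base => exact fun v hv => ⟨v, hv, fun _ _ => rfl⟩
  | succ n h ih =>
    intro v hv
    obtain ⟨d, hpd, hd⟩ := hskip n (hN.trans h) v hv
    obtain ⟨v', hv', heq⟩ := ih _ hd
    refine ⟨v', hv', fun j hj => (heq j hj).trans ?_⟩
    rw [Fin.removeNth_apply, Fin.succAbove_of_castSucc_lt d (j.castLE h) (hj.trans_le hpd)]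
    rfl

section Minimal

variable [PartialOrder α] [OrderBot α] [WellQuasiOrderedLE α]

theorem eventually_minimal_eq_insertNth (hM : IsIncClosed i M) (hip : i ≤ p) :
    ∀ᶠ n in atTop, ∀ v, Minimal (· ∈ M (n + 1)) v → ∃ (d : Fin (n + 1)) (u : Fin n → α),
      p ≤ (d : ℕ) ∧ Minimal (· ∈ M n) u ∧ v = d.insertNth (α := fun _ => α) ⊥ u := by
  filter_upwards [hM.eventually_exists_removeNth_mem hip, eventually_ge_atTop 1]
    with n hskip hn v hv
  obtain ⟨d, hpd, hd⟩ := hskip v hv.prop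
  obtain ⟨u, huv, hu⟩ := exists_minimal_le_of_wellFoundedLT (· ∈ M n) _ hd
  refine ⟨d, u, hpd, hu,
    (hv.eq_of_le (hM.insertNth_mem hn (hip.trans hpd) hu.prop ⊥) ?_).symm⟩
  exact Fin.insertNth_le_iff.2 ⟨bot_le, huv⟩

theorem eventually_forall_minimal_succ (hM : IsIncClosed i M) (p : ℕ) :
    ∀ᶠ n in atTop, ∀ Q : α → Prop, Q ⊥ →
      (∀ u, Minimal (· ∈ M n) u → ∀ j : Fin n, p ≤ (j : ℕ) → Q (u j)) →
      ∀ v, Minimal (· ∈ M (n + 1)) v → ∀ j : Fin (n + 1), p ≤ (j : ℕ) → Q (v j) := by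
  filter_upwards [hM.eventually_minimal_eq_insertNth (le_max_left i p)]
    with n hn Q hbot hQ v hv j hj
  obtain ⟨d, u, hpd, hu, rfl⟩ := hn v hv
  rcases eq_or_ne j d with rfl | hjd
  · rwa [Fin.insertNth_apply_same]
  · obtain ⟨k, rfl⟩ := Fin.exists_succAbove_eq hjd
    rw [Fin.insertNth_apply_succAbove]
    refine hQ u hu k ?_
    rcases lt_or_ge k.castSucc d with hlt | hge
    · rwa [Fin.succAbove_of_castSucc_lt _ _ hlt] at hj
    · exact (le_max_right i p).trans (hpd.trans hge)

end Minimal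

end IsIncClosed

/-! ### Column thresholds -/

open Classical in
/-- The positions from `P` on at which the word `v` is at least `a`. -/
def largeColumns {α : Type*} [LE α] {n : ℕ} (P : ℕ) (a : α) (v : Fin n → α) : Finset (Fin n) :=
  Finset.univ.filter fun j => P ≤ (j : ℕ) ∧ a ≤ v j

theorem mem_largeColumns {α : Type*} [LE α] {n P : ℕ} {a : α} {v : Fin n → α} {j : Fin n} :
    j ∈ largeColumns P a v ↔ P ≤ (j : ℕ) ∧ a ≤ v j := by
  simp [largeColumns]

/-- Membership in `M n` of a word with at least `N` letters `≥ a` in positions `≥ P` depends only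
on its first `P` letters: it suffices that they dominate those of some element of `M n`. -/
def IsColumnThreshold {α : Type*} [LE α] (M : (n : ℕ) → Set (Fin n → α)) (P N : ℕ) (a : α) :
    Prop :=
  ∀ ⦃n⦄ (u v : Fin n → α), v ∈ M n → (∀ j : Fin n, (j : ℕ) < P → v j ≤ u j) →
    N ≤ (largeColumns P a u).card → u ∈ M n

/-- Some member of the family vanishes in the first `i` positions and is bounded by `a`. For a chain
of ideals, the eventual value of `ω` is the least `e` for which this holds with `a = (e, …, e)`,
provided there is one. -/
def HasAvoidingMember {α : Type*} [LE α] [OrderBot α] (i : ℕ) (M : (n : ℕ) → Set (Fin n → α))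
    (a : α) : Prop :=
  ∃ n, 1 ≤ n ∧ ∃ v ∈ M n, (∀ j : Fin n, (j : ℕ) < i → v j = ⊥) ∧ ∀ j, v j ≤ a

namespace IsIncClosed

variable {α : Type*} [PartialOrder α] {i : ℕ} {M : (n : ℕ) → Set (Fin n → α)}

theorem exists_forall_mem_of_hasAvoidingMember [OrderBot α] (hM : IsIncClosed i M) {a : α}
    (ha : HasAvoidingMember i M a) {P : ℕ} (hiP : i ≤ P) :
    ∃ N, ∀ ⦃n⦄ (u : Fin n → α), N ≤ (largeColumns P a u).card → u ∈ M n := by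
  obtain ⟨m, hm, v, hv, hbot, hle⟩ := ha
  refine ⟨m, fun n u hN => hM.mem_of_le_card le_rfl hm hv hN
    (fun l hl => hiP.trans (mem_largeColumns.1 hl).1) (fun j hj _ hji => ?_) fun j _ l hl =>
    (hle j).trans (mem_largeColumns.1 hl).2⟩
  rw [hbot ⟨j, hj⟩ hji]
  exact bot_le

theorem eventually_exists_isColumnThreshold [WellQuasiOrderedLE α] (hM : IsIncClosed i M) {P : ℕ}
    (hiP : i ≤ P) : ∀ᶠ N in atTop, ∀ a,
      (∀ g, Minimal (· ∈ M N) g → ∀ j : Fin N, P ≤ (j : ℕ) → g j ≤ a) →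
      IsColumnThreshold M P N a := by
  filter_upwards [hM.eventually_exists_eq_on_prefix hiP, eventually_ge_atTop 1]
    with N hprefix hN a hbound n u v hv hvu hcard
  obtain ⟨v', hv', heq⟩ := hprefix n
    (hcard.trans ((Finset.card_le_univ _).trans_eq (Fintype.card_fin n))) v hv
  obtain ⟨g, hgv', hg⟩ := exists_minimal_le_of_wellFoundedLT (· ∈ M N) v' hv'
  refine hM.mem_of_le_card hiP hN hg.prop hcard (fun l hl => (mem_largeColumns.1 hl).1)
    (fun j hj hj' hjP => ?_) fun j hj l hl => (hbound g hg j hj).trans (mem_largeColumns.1 hl).2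
  exact (hgv' _).trans ((heq _ hjP).trans_le (hvu _ hjP))

end IsIncClosed

/-! ### Exponent columns of monomials -/

section Columns

variable {K : Type*} [Field K] {c m n : ℕ}

theorem monomial_mem_of_le {τ : Type*} {J : Ideal (MvPolynomial τ K)} {u v : τ →₀ ℕ}
    (hu : monomial u (1 : K) ∈ J) (huv : u ≤ v) : monomial v (1 : K) ∈ J :=
  J.mem_of_dvd (monomial_dvd_monomial.2 ⟨Or.inr huv, one_dvd 1⟩) hu

/-- Exponent vectors of monomials of `R_n`, read as words of length `n` of columns in `ℕ^c`. -/
def columns : (FinVar c n →₀ ℕ) ≃o (Fin n → Fin c → ℕ) where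
  toFun u j k := u (toLex (k, j))
  invFun v := Finsupp.equivFunOnFinite.symm fun x => v (ofLex x).2 (ofLex x).1
  left_inv _ := Finsupp.ext fun _ => rfl
  right_inv _ := rfl
  map_rel_iff' := ⟨fun h x => h (ofLex x).2 (ofLex x).1, fun h j k => h (toLex (k, j))⟩

theorem columns_apply (u : FinVar c n →₀ ℕ) (j : Fin n) (k : Fin c) :
    columns u j k = u (toLex (k, j)) :=
  rfl

/-- The words of columns of the monomials in `J`. -/
def columnSet (J : Ideal (MvPolynomial (FinVar c n) K)) : Set (Fin n → Fin c → ℕ) :=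
  {v | monomial (columns.symm v) (1 : K) ∈ J}

theorem columns_mem_columnSet {J : Ideal (MvPolynomial (FinVar c n) K)} {u : FinVar c n →₀ ℕ} :
    columns u ∈ columnSet J ↔ monomial u (1 : K) ∈ J := by
  rw [columnSet, Set.mem_ofPred_eq, OrderIso.symm_apply_apply]

theorem minimal_columnSet_iff {J : Ideal (MvPolynomial (FinVar c n) K)}
    {v : Fin n → Fin c → ℕ} : Minimal (· ∈ columnSet J) v ↔ columns.symm v ∈ minGens J := by
  refine ⟨fun h => ⟨h.prop, fun u hu huv => ?_⟩, fun h => ⟨h.1, fun u hu huv => ?_⟩⟩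
  · rw [← OrderIso.symm_apply_apply columns u, h.eq_of_le (columns_mem_columnSet.2 hu)
      ((OrderIso.le_symm_apply _).1 huv)]
  · exact (columns.symm.injective (h.2 _ hu (columns.symm.monotone huv))).ge

/-- The map of variables `x_{k,j} ↦ x_{k,π(j)}` from `R_m` to `R_n`. -/
def columnMap (π : Fin m → Fin n) (x : FinVar c m) : FinVar c n :=
  toLex ((ofLex x).1, π (ofLex x).2)

theorem columnMap_injective {π : Fin m → Fin n} (hπ : Function.Injective π) :
    Function.Injective (columnMap (c := c) π) := fun x y hxy => by
  obtain ⟨h₁, h₂⟩ := Prod.ext_iff.1 (toLex.injective hxy)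
  exact ofLex.injective (Prod.ext h₁ (hπ h₂))

theorem varIncl_injective (c n : ℕ) : Function.Injective (varIncl c n) := fun x y hxy => by
  obtain ⟨h₁, h₂⟩ := Prod.ext_iff.1 hxy
  exact ofLex.injective (Prod.ext h₁ (Fin.val_injective h₂))

theorem varIncl_comp_columnMap {π : Fin m → Fin n} {ρ : ℕ → ℕ} (hρ : ∀ j : Fin m, ρ j = π j) :
    varIncl c n ∘ columnMap π = varAct c ρ ∘ varIncl c m :=
  funext fun x => Prod.ext rfl (hρ (ofLex x).2).symm

theorem mapDomain_columnMap_le {π : Fin m → Fin n} (hπ : Function.Injective π)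
    {u : Fin m → Fin c → ℕ} {v : Fin n → Fin c → ℕ} (huv : ∀ j, u j ≤ v (π j)) :
    (columns.symm u).mapDomain (columnMap π) ≤ columns.symm v := by
  intro x
  by_cases hx : x ∈ Set.range (columnMap π)
  · obtain ⟨y, rfl⟩ := hx
    rw [Finsupp.mapDomain_apply (columnMap_injective hπ)]
    exact huv (ofLex y).2 (ofLex y).1
  · rw [Finsupp.mapDomain_of_notMem_range _ _ hx]
    exact Nat.zero_le _

end Columns

/-! ### The chain of initial ideals is invariant -/

section Invariance

variable {K : Type*} [Field K] {c i m n : ℕ}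

theorem exists_incMonoid_extension (π : Fin m ↪o Fin n)
    (hfix : ∀ j : Fin m, (j : ℕ) < i → (π j : ℕ) = j) :
    ∃ ρ ∈ IncMonoid i, ∀ j : Fin m, ρ j = π j := by
  rcases lt_or_ge m i with hmi | him
  · exact ⟨id, ⟨strictMono_id, fun _ _ => rfl⟩, fun j => (hfix j (j.2.trans hmi)).symm⟩
  · refine ⟨fun j => if h : j < m then π ⟨j, h⟩ else n + j, ⟨fun j l hjl => ?_, fun j hj => ?_⟩,
      fun j => dif_pos j.2⟩
    · by_cases hl : l < m
      · simp only [dif_pos hl, dif_pos (hjl.trans hl)]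
        exact π.strictMono (Fin.mk_lt_mk.2 hjl)
      · simp only [dif_neg hl]
        split_ifs with hj
        · exact (π ⟨j, hj⟩).2.trans_le (Nat.le_add_right n l)
        · exact Nat.add_lt_add_left hjl n
    · simp only [dif_pos (hj.trans_le him)]
      exact hfix ⟨j, hj.trans_le him⟩ hj

theorem IsIncInvariant.rename_columnMap_mem {I : (n : ℕ) → Ideal (MvPolynomial (FinVar c n) K)}
    (hinv : IsIncInvariant i I) (hm : 1 ≤ m) (π : Fin m ↪o Fin n)
    (hfix : ∀ j : Fin m, (j : ℕ) < i → (π j : ℕ) = j) {f : MvPolynomial (FinVar c m) K}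
    (hf : f ∈ I m) : rename (columnMap π) f ∈ I n := by
  obtain ⟨ρ, hρ, hρπ⟩ := exists_incMonoid_extension π hfix
  have hmn : m ≤ n := by simpa using Fintype.card_le_of_embedding π.toEmbedding
  obtain ⟨g, hg, hgf⟩ := hinv m n hm hmn ρ hρ
    (fun j hj => (hρπ ⟨j, hj⟩).trans_lt (π ⟨j, hj⟩).2) f hf
  have hgf' : g = rename (columnMap π) f := by
    refine rename_injective _ (varIncl_injective c n) (hgf.trans ?_)
    rw [ringIncl, rename_rename, rename_rename, varIncl_comp_columnMap hρπ]
  rwa [← hgf']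

theorem IsMonomialOrder.restrictOrder {le : (InfVar c →₀ ℕ) → (InfVar c →₀ ℕ) → Prop}
    (hle : IsMonomialOrder le) (n : ℕ) : IsMonomialOrder (restrictOrder le n) where
  total _ _ := hle.total _ _
  antisymm _ _ huv hvu :=
    Finsupp.mapDomain_injective (varIncl_injective c n) (hle.antisymm _ _ huv hvu)
  trans _ _ _ huv hvw := hle.trans _ _ _ huv hvw
  zero_le u := by
    rw [_root_.restrictOrder, Finsupp.mapDomain_zero]
    exact hle.zero_le _
  add_le_add u v w huv := by
    rw [_root_.restrictOrder, Finsupp.mapDomain_add, Finsupp.mapDomain_add]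
    exact hle.add_le_add _ _ _ huv

theorem RespectsInc.restrictOrder_mapDomain {le : (InfVar c →₀ ℕ) → (InfVar c →₀ ℕ) → Prop}
    (hresp : RespectsInc i le) (π : Fin m ↪o Fin n)
    (hfix : ∀ j : Fin m, (j : ℕ) < i → (π j : ℕ) = j) {u v : FinVar c m →₀ ℕ}
    (huv : restrictOrder le m u v) :
    restrictOrder le n (u.mapDomain (columnMap π)) (v.mapDomain (columnMap π)) := by
  obtain ⟨ρ, hρ, hρπ⟩ := exists_incMonoid_extension π hfix
  rw [restrictOrder, ← Finsupp.mapDomain_comp, ← Finsupp.mapDomain_comp,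
    varIncl_comp_columnMap hρπ, Finsupp.mapDomain_comp, Finsupp.mapDomain_comp]
  exact hresp ρ hρ _ _ huv

theorem isIncClosed_initialChain {I : (n : ℕ) → Ideal (MvPolynomial (FinVar c n) K)}
    (hinv : IsIncInvariant i I) {le : (InfVar c →₀ ℕ) → (InfVar c →₀ ℕ) → Prop}
    (hle : IsMonomialOrder le) (hresp : RespectsInc i le) :
    IsIncClosed i fun n => columnSet (initialChain le I n) := by
  classical
  intro m n hm π hfix u hu v huv
  obtain ⟨f, hf, hlead, hmax⟩ := (monomial_mem_initialIdeal_iff (hle.restrictOrder m)).1 hu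
  have hinj : Function.Injective (columnMap (c := c) π) := columnMap_injective π.injective
  have hsupp := support_rename_of_injective (p := f) hinj
  refine monomial_mem_of_le ((monomial_mem_initialIdeal_iff (hle.restrictOrder n)).2
    ⟨_, hinv.rename_columnMap_mem hm π hfix hf, ?_, fun t ht => ?_⟩)
    (mapDomain_columnMap_le π.injective huv)
  · rw [hsupp]
    exact Finset.mem_image_of_mem _ hlead
  · rw [hsupp] at ht
    obtain ⟨s, hs, rfl⟩ := Finset.mem_image.1 ht
    exact hresp.restrictOrder_mapDomain π hfix (hmax s hs)

end Invariance

/-! ### Weights of minimal generators -/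

section Weights

variable {K : Type*} [Field K]

theorem minGens_finite {τ : Type*} [Finite τ] (J : Ideal (MvPolynomial τ K)) :
    (minGens J).Finite :=
  WellQuasiOrderedLE.finite_of_isAntichain fun u hu _ hv huv hle => huv (hv.2 u hu.1 hle)

theorem exists_minGens_le {τ : Type*} {J : Ideal (MvPolynomial τ K)} {u : τ →₀ ℕ}
    (hu : monomial u (1 : K) ∈ J) : ∃ g ∈ minGens J, g ≤ u := by
  obtain ⟨g, hgu, hg⟩ := exists_minimal_le_of_wellFoundedLT
    (fun v : τ →₀ ℕ => monomial v (1 : K) ∈ J) u hu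
  exact ⟨g, ⟨hg.prop, fun v hv hvg => (hg.eq_of_ge hv hvg).symm⟩, hgu⟩

theorem sSup_image_minGens_le_iff {τ : Type*} [Finite τ] {J : Ideal (MvPolynomial τ K)}
    {w : (τ →₀ ℕ) → ℕ} {t : ℕ} : sSup (w '' minGens J) ≤ t ↔ ∀ g ∈ minGens J, w g ≤ t := by
  refine ⟨fun h g hg => (le_csSup ((minGens_finite J).image w).bddAbove ⟨g, hg, rfl⟩).trans h,
    fun h => csSup_le' ?_⟩
  rintro _ ⟨g, hg, rfl⟩
  exact h g hg

variable {c n p q : ℕ} {J : Ideal (MvPolynomial (FinVar c n) K)}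

theorem rowWeight_le_iff {k : Fin c} {u : FinVar c n →₀ ℕ} {t : ℕ} :
    rowWeight p k u ≤ t ↔ ∀ j : Fin n, p ≤ (j : ℕ) → columns u j k ≤ t := by
  simp [rowWeight, Finset.sup_le_iff, columns_apply]

theorem weight_le_iff {u : FinVar c n →₀ ℕ} {t : ℕ} :
    weight p u ≤ t ↔ ∀ j : Fin n, p ≤ (j : ℕ) → ∀ k, columns u j k ≤ t := by
  simp only [weight, Finset.sup_le_iff, Finset.mem_univ, true_imp_iff, rowWeight_le_iff]
  exact ⟨fun h j hj k => h k j hj, fun h k j hj => h j hj k⟩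

theorem idealRowWeight_le_iff {k : Fin c} {t : ℕ} :
    idealRowWeight p k J ≤ t ↔
      ∀ g ∈ minGens J, ∀ j : Fin n, p ≤ (j : ℕ) → columns g j k ≤ t := by
  rw [idealRowWeight, sSup_image_minGens_le_iff]
  simp only [rowWeight_le_iff]

theorem columns_le_idealRowWeight {g : FinVar c n →₀ ℕ} (hg : g ∈ minGens J) {j : Fin n}
    (hj : p ≤ (j : ℕ)) (k : Fin c) : columns g j k ≤ idealRowWeight p k J :=
  idealRowWeight_le_iff.1 le_rfl g hg j hj

theorem sSup_weight_minGens :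
    sSup (weight p '' minGens J) = Finset.univ.sup fun k => idealRowWeight p k J := by
  refine eq_of_forall_ge_iff fun t => ?_
  simp only [sSup_image_minGens_le_iff, Finset.sup_le_iff, weight_le_iff, idealRowWeight_le_iff,
    Finset.mem_univ, true_imp_iff]
  exact ⟨fun h k g hg j hj => h g hg j hj k, fun h g hg j hj k => h k g hg j hj⟩

theorem idealRowWeight_antitone (k : Fin c) (J : Ideal (MvPolynomial (FinVar c n) K)) :
    Antitone fun p => idealRowWeight p k J := fun _ _ hpq =>
  idealRowWeight_le_iff.2 fun _ hg _ hj => columns_le_idealRowWeight hg (hpq.trans hj) k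

end Weights

section EventualValues

theorem exists_eventually_eq_of_succ_le {a : ℕ → ℕ} (h : ∀ᶠ n in atTop, a (n + 1) ≤ a n) :
    ∃ v, ∀ᶠ n in atTop, a n = v := by
  obtain ⟨n₀, hn₀⟩ := eventually_atTop.1 h
  have hanti : Antitone fun n => a (n + n₀) := antitone_nat_of_succ_le fun n => by
    rw [add_right_comm]
    exact hn₀ _ (Nat.le_add_left _ _)
  obtain ⟨n₁, hn₁⟩ := WellFoundedLT.antitone_chain_condition hanti
  refine ⟨a (n₁ + n₀), eventually_atTop.2 ⟨n₁ + n₀, fun n hn => ?_⟩⟩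
  rw [hn₁ (n - n₀) (by omega), Nat.sub_add_cancel (by omega)]

theorem eventualValue_eq {a : ℕ → ℕ} {v : ℕ} (h : ∀ᶠ n in atTop, a n = v) :
    eventualValue a = v := by
  have hset : {v | ∀ᶠ n in atTop, a n = v} = {v} := by
    refine Set.eq_singleton_iff_unique_mem.2 ⟨h, fun v' h' => ?_⟩
    obtain ⟨n, hn, hn'⟩ := (h.and h').exists
    exact hn'.symm.trans hn
  rw [eventualValue, hset, csInf_singleton]

theorem eventualValue_eventualValue_eq {a : ℕ → ℕ → ℕ} {v : ℕ}
    (h : ∀ᶠ p in atTop, ∀ᶠ n in atTop, a p n = v) :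
    eventualValue (fun p => eventualValue (a p)) = v :=
  eventualValue_eq (h.mono fun _ hp => eventualValue_eq hp)

variable {K : Type*} [Field K] {c i : ℕ} {J : (n : ℕ) → Ideal (MvPolynomial (FinVar c n) K)}

theorem eventually_idealRowWeight_succ_le (hJ : IsIncClosed i fun n => columnSet (J n)) (p : ℕ)
    (k : Fin c) : ∀ᶠ n in atTop, idealRowWeight p k (J (n + 1)) ≤ idealRowWeight p k (J n) := by
  filter_upwards [hJ.eventually_forall_minimal_succ p] with n hn
  refine idealRowWeight_le_iff.2 fun g hg =>
    hn (fun x => x k ≤ idealRowWeight p k (J n)) (Nat.zero_le _) (fun u hu j hj => ?_) _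
      (minimal_columnSet_iff.2 ((columns.symm_apply_apply g).symm ▸ hg))
  exact columns_le_idealRowWeight (minimal_columnSet_iff.1 hu) hj k

theorem exists_eventually_idealRowWeight_eq (hJ : IsIncClosed i fun n => columnSet (J n))
    (k : Fin c) :
    ∃ w, ∀ᶠ p in atTop, ∀ᶠ n in atTop, idealRowWeight p k (J n) = w := by
  choose w hw using fun p =>
    exists_eventually_eq_of_succ_le (a := fun n => idealRowWeight p k (J n))
      (eventually_idealRowWeight_succ_le hJ p k)
  obtain ⟨v, hv⟩ := exists_eventually_eq_of_succ_le (a := w) (Eventually.of_forall fun p => by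
    obtain ⟨n, hn, hn'⟩ := ((hw p).and (hw (p + 1))).exists
    rw [← hn, ← hn']
    exact idealRowWeight_antitone k (J n) p.le_succ)
  exact ⟨v, hv.mono fun p hp => (hw p).mono fun n hn => hn.trans hp⟩

theorem exists_eventually_minGens_le (hJ : IsIncClosed i fun n => columnSet (J n)) :
    ∃ W, ∀ᶠ n in atTop, ∀ g ∈ minGens (J n), ∀ j k, columns g j k ≤ W := by
  choose w hw using fun k =>
    exists_eventually_eq_of_succ_le (a := fun n => idealRowWeight 0 k (J n))
      (eventually_idealRowWeight_succ_le hJ 0 k)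
  refine ⟨Finset.univ.sup w, (eventually_all.2 hw).mono fun n hn g hg j k => ?_⟩
  exact (columns_le_idealRowWeight hg (Nat.zero_le _) k).trans
    ((hn k).trans_le (Finset.le_sup (Finset.mem_univ k)))

end EventualValues

/-! ### The eventual value of `ω` -/

section Omega

variable {K : Type*} [Field K] {c n p : ℕ} {J : Ideal (MvPolynomial (FinVar c n) K)}

/-- The minimal generators that involve none of the first `p` columns. In contrast to
`minGensPlus`, the generator `1` is allowed, which avoids a case distinction. -/
def avoidingMinGens (p : ℕ) (J : Ideal (MvPolynomial (FinVar c n) K)) : Set (FinVar c n →₀ ℕ) :=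
  {u | u ∈ minGens J ∧ ∀ j : Fin n, (j : ℕ) < p → columns u j = ⊥}

theorem mem_minGensPlus_iff {u : FinVar c n →₀ ℕ} :
    u ∈ minGensPlus p J ↔ u ∈ avoidingMinGens p J ∧ u ≠ 0 := by
  have hsupp : (∀ x ∈ u.support, p ≤ ((ofLex x).2 : ℕ)) ↔
      ∀ j : Fin n, (j : ℕ) < p → columns u j = ⊥ := by
    refine ⟨fun h j hj => funext fun k => ?_, fun h x hx => ?_⟩
    · by_contra hne
      exact hj.not_ge (h (toLex (k, j)) (Finsupp.mem_support_iff.2 hne))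
    · by_contra! hlt
      exact Finsupp.mem_support_iff.1 hx (congrFun (h _ hlt) (ofLex x).1)
  rw [minGensPlus, Set.mem_ofPred_eq, hsupp, avoidingMinGens, Set.mem_ofPred_eq]
  tauto

theorem idealOmega_eq_sInf_of_nonempty (h : (avoidingMinGens p J).Nonempty) :
    idealOmega p J = sInf (weight p '' avoidingMinGens p J) := by
  by_cases h0 : 0 ∈ minGens J
  · have hgens : minGens J = {0} := Set.eq_singleton_iff_unique_mem.2
      ⟨h0, fun g hg => (hg.2 0 h0.1 zero_le).symm⟩
    have havoid : avoidingMinGens p J = {0} :=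
      h.subset_singleton_iff.1 fun g hg => hgens ▸ hg.1
    have hplus : ¬ (minGensPlus p J).Nonempty := fun ⟨g, hg⟩ =>
      hg.2.1 (Set.mem_singleton_iff.1 (hgens ▸ hg.1))
    rw [idealOmega, if_neg hplus, hgens, havoid, Set.image_singleton, csSup_singleton,
      csInf_singleton]
  · have hplus : minGensPlus p J = avoidingMinGens p J := Set.ext fun g =>
      mem_minGensPlus_iff.trans (and_iff_left_of_imp fun hg hg0 => h0 (hg0 ▸ hg.1))
    rw [idealOmega, hplus, if_pos h]

theorem idealOmega_eq_sup_of_not_nonempty (h : ¬ (avoidingMinGens p J).Nonempty) :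
    idealOmega p J = Finset.univ.sup fun k => idealRowWeight p k J := by
  have hplus : ¬ (minGensPlus p J).Nonempty := fun ⟨g, hg⟩ =>
    h ⟨g, (mem_minGensPlus_iff.1 hg).1⟩
  rw [idealOmega, if_neg hplus, sSup_weight_minGens]

variable {i : ℕ} {J : (n : ℕ) → Ideal (MvPolynomial (FinVar c n) K)}

theorem hasAvoidingMember_weight (hip : i ≤ p) (hn : 1 ≤ n) {u : FinVar c n →₀ ℕ}
    (hu : u ∈ avoidingMinGens p (J n)) :
    HasAvoidingMember i (fun n => columnSet (J n)) fun _ => weight p u := by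
  refine ⟨n, hn, columns u, columns_mem_columnSet.2 hu.1.1, fun j hj => hu.2 j (hj.trans_le hip),
    fun j => ?_⟩
  rcases lt_or_ge (j : ℕ) p with hj | hj
  · rw [hu.2 j hj]
    exact bot_le
  · exact weight_le_iff.1 le_rfl j hj

theorem eventually_exists_mem_avoidingMinGens (hJ : IsIncClosed i fun n => columnSet (J n))
    {e : ℕ} (he : HasAvoidingMember i (fun n => columnSet (J n)) fun _ => e) (hip : i ≤ p) :
    ∀ᶠ n in atTop, ∃ g ∈ avoidingMinGens p (J n), weight p g ≤ e := by
  obtain ⟨N, hN⟩ := hJ.exists_forall_mem_of_hasAvoidingMember he hip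
  filter_upwards [eventually_ge_atTop (p + N)] with n hn
  let v (j : Fin n) : Fin c → ℕ := if (j : ℕ) < p then ⊥ else fun _ => e
  have hv_lt {j : Fin n} (hj : (j : ℕ) < p) : v j = ⊥ := if_pos hj
  have hv_ge {j : Fin n} (hj : p ≤ (j : ℕ)) : v j = fun _ => e := if_neg hj.not_gt
  have hsmall : (largeColumns p (fun _ => e) v)ᶜ ⊆
      Finset.univ.filter fun j : Fin n => (j : ℕ) < p := fun j hj => by
    contrapose! hj
    have hpj : p ≤ (j : ℕ) := by simpa using hj
    simpa using mem_largeColumns.2 ⟨hpj, (hv_ge hpj).ge⟩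
  have hcard := Finset.card_le_card hsmall
  rw [Finset.card_compl, Fintype.card_fin, Fin.card_filter_val_lt] at hcard
  obtain ⟨g, hg, hgv⟩ := exists_minGens_le (hN v (by omega))
  replace hgv := (OrderIso.le_symm_apply _).1 hgv
  refine ⟨g, ⟨hg, fun j hj => le_bot_iff.1 ((hgv j).trans_eq (hv_lt hj))⟩, ?_⟩
  exact weight_le_iff.2 fun j hj => (hgv j).trans_eq (hv_ge hj)

theorem eventually_idealOmega_eq_of_isLeast (hJ : IsIncClosed i fun n => columnSet (J n)) {e : ℕ}
    (he : IsLeast {e | HasAvoidingMember i (fun n => columnSet (J n)) fun _ => e} e)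
    (hip : i ≤ p) : ∀ᶠ n in atTop, idealOmega p (J n) = e := by
  filter_upwards [eventually_exists_mem_avoidingMinGens hJ he.1 hip, eventually_ge_atTop 1]
    with n hex hn
  obtain ⟨g, hg, hge⟩ := hex
  rw [idealOmega_eq_sInf_of_nonempty ⟨g, hg⟩]
  refine le_antisymm ((Nat.sInf_le (Set.mem_image_of_mem _ hg)).trans hge)
    (le_csInf (Set.Nonempty.image _ ⟨g, hg⟩) ?_)
  rintro _ ⟨u, hu, rfl⟩
  exact he.2 (hasAvoidingMember_weight hip hn hu)

theorem eventually_idealRowWeight_eq_chainRowWeight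
    (hJ : IsIncClosed i fun n => columnSet (J n)) (k : Fin c) :
    ∀ᶠ p in atTop, ∀ᶠ n in atTop, idealRowWeight p k (J n) = chainRowWeight J k := by
  obtain ⟨w, hw⟩ := exists_eventually_idealRowWeight_eq hJ k
  rwa [chainRowWeight, eventualValue_eventualValue_eq hw]

theorem eventually_exists_isColumnThreshold_sup (hJ : IsIncClosed i fun n => columnSet (J n)) :
    ∀ᶠ P in atTop, ∃ N, IsColumnThreshold (fun n => columnSet (J n)) P N
      fun _ => Finset.univ.sup (chainRowWeight J) := by
  filter_upwards [eventually_all.2 (eventually_idealRowWeight_eq_chainRowWeight hJ),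
    eventually_ge_atTop i] with P hw hiP
  obtain ⟨N, hN, hwN⟩ :=
    ((hJ.eventually_exists_isColumnThreshold hiP).and (eventually_all.2 hw)).exists
  refine ⟨N, hN _ fun g hg j hj k => ?_⟩
  exact (columns_le_idealRowWeight (minimal_columnSet_iff.1 hg) hj k).trans
    ((hwN k).trans_le (Finset.le_sup (Finset.mem_univ k)))

theorem eventually_idealOmega_eq_sup (hJ : IsIncClosed i fun n => columnSet (J n))
    (h : ∀ e, ¬ HasAvoidingMember i (fun n => columnSet (J n)) fun _ => e) :
    ∀ᶠ p in atTop, ∀ᶠ n in atTop,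
      idealOmega p (J n) = Finset.univ.sup (chainRowWeight J) := by
  filter_upwards [eventually_all.2 (eventually_idealRowWeight_eq_chainRowWeight hJ),
    eventually_ge_atTop i] with p hw hip
  filter_upwards [eventually_all.2 hw, eventually_ge_atTop 1] with n hwn hn
  rw [idealOmega_eq_sup_of_not_nonempty fun ⟨u, hu⟩ => h _ (hasAvoidingMember_weight hip hn hu)]
  simp only [hwn]

theorem exists_eventually_idealOmega_eq_and_isColumnThreshold
    (hJ : IsIncClosed i fun n => columnSet (J n)) :
    ∃ ω, (∀ᶠ p in atTop, ∀ᶠ n in atTop, idealOmega p (J n) = ω) ∧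
      ∀ᶠ P in atTop, ∃ N, IsColumnThreshold (fun n => columnSet (J n)) P N fun _ => ω := by
  by_cases! h : ∃ e, HasAvoidingMember i (fun n => columnSet (J n)) fun _ => e
  · classical
    refine ⟨Nat.find h, ?_, ?_⟩
    · filter_upwards [eventually_ge_atTop i] with p hip
      exact eventually_idealOmega_eq_of_isLeast hJ (Nat.isLeast_find h) hip
    · filter_upwards [eventually_ge_atTop i] with P hiP
      obtain ⟨N, hN⟩ := hJ.exists_forall_mem_of_hasAvoidingMember (Nat.find_spec h) hiP
      exact ⟨N, fun _ u _ _ _ hcard => hN u hcard⟩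
  · exact ⟨_, eventually_idealOmega_eq_sup hJ h, eventually_exists_isColumnThreshold_sup hJ⟩

theorem eventually_idealOmega_eq_chainOmega (hJ : IsIncClosed i fun n => columnSet (J n)) :
    ∀ᶠ p in atTop, ∀ᶠ n in atTop, idealOmega p (J n) = chainOmega J := by
  obtain ⟨ω, hω, -⟩ := exists_eventually_idealOmega_eq_and_isColumnThreshold hJ
  rwa [chainOmega, eventualValue_eventualValue_eq hω]

theorem eventually_exists_isColumnThreshold_chainOmega
    (hJ : IsIncClosed i fun n => columnSet (J n)) :
    ∀ᶠ P in atTop, ∃ N, IsColumnThreshold (fun n => columnSet (J n)) P N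
      fun _ => chainOmega J := by
  obtain ⟨ω, hω, hthreshold⟩ := exists_eventually_idealOmega_eq_and_isColumnThreshold hJ
  rwa [chainOmega, eventualValue_eventualValue_eq hω]

end Omega

/-! ### Cone apexes in large degrees -/

section ConeApex

variable {K : Type*} [Field K]

theorem hasConeApex_intro {σ : Type*} [DecidableEq σ] {J : Ideal (MvPolynomial σ K)} {p : ℕ}
    {m : σ →₀ ℕ} {x : σ} (hx : 1 ≤ m x)
    (h : ∀ (A : Finset σ) (u : σ →₀ ℕ), A.card = p → x ∉ A →
      u + finsetExponent (insert x A) = m → monomial (u + Finsupp.single x 1) (1 : K) ∈ J →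
        monomial u (1 : K) ∈ J) :
    HasConeApex J p m := by
  refine ⟨x, fun A hA hcard => ?_⟩
  by_cases hxA : x ∈ A
  · rwa [Finset.insert_eq_of_mem hxA]
  obtain ⟨u, rfl, hu⟩ := hA
  have hle : Finsupp.single x 1 ≤ u := by
    rw [Finsupp.single_le_iff]
    simpa [finsetExponent_apply, hxA] using hx
  have hsum : u - Finsupp.single x 1 + finsetExponent (insert x A) = u + finsetExponent A := by
    rw [finsetExponent_insert hxA, ← add_assoc, tsub_add_cancel_of_le hle]
  exact ⟨_, hsum, h A _ hcard hxA hsum (by rwa [tsub_add_cancel_of_le hle])⟩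

theorem le_of_not_hasConeApex {σ : Type*} [DecidableEq σ] {J : Ideal (MvPolynomial σ K)}
    {p : ℕ} {m : σ →₀ ℕ} (hm : ¬ HasConeApex J p m) {x : σ} {t : ℕ}
    (ht : ∀ g ∈ minGens J, g x ≤ t) : m x ≤ t := by
  by_contra! htx
  refine hm (hasConeApex_intro (Nat.one_le_of_lt htx) fun A u _ _ hum hu => ?_)
  obtain ⟨g, hg, hgu⟩ := exists_minGens_le hu
  refine monomial_mem_of_le hg.1 fun y => ?_
  rcases eq_or_ne y x with rfl | hyx
  · have hy := DFunLike.congr_fun hum y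
    rw [Finsupp.add_apply, finsetExponent_apply, if_pos (Finset.mem_insert_self _ _)] at hy
    exact (ht g hg).trans (by omega)
  · simpa [Finsupp.single_eq_of_ne hyx] using hgu y

variable {c n P p : ℕ}

theorem card_largeColumns_add_finsetExponent_le (a : Fin c → ℕ) (u : FinVar c n →₀ ℕ)
    (B : Finset (FinVar c n)) :
    (largeColumns P a (columns (u + finsetExponent B))).card ≤
      (largeColumns P a (columns u)).card + B.card := by
  classical
  have hsub : largeColumns P a (columns (u + finsetExponent B)) ⊆
      largeColumns P a (columns u) ∪ B.image fun x => (ofLex x).2 := by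
    intro j hj
    by_contra hnot
    rw [Finset.mem_union, not_or] at hnot
    obtain ⟨hPj, haj⟩ := mem_largeColumns.1 hj
    refine hnot.1 (mem_largeColumns.2 ⟨hPj, haj.trans_eq (funext fun k => ?_)⟩)
    have hnotB : toLex (k, j) ∉ B := fun hmem => hnot.2 (Finset.mem_image.2 ⟨_, hmem, rfl⟩)
    rw [columns_apply, Finsupp.add_apply, finsetExponent_apply, if_neg hnotB, add_zero,
      columns_apply]
  exact (Finset.card_le_card hsub).trans
    ((Finset.card_union_le _ _).trans (Nat.add_le_add_left Finset.card_image_le _))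

theorem largeColumns_succ_add_finsetExponent_subset (a : Fin c → ℕ) (u : FinVar c n →₀ ℕ)
    (B : Finset (FinVar c n)) :
    largeColumns P (a + 1) (columns (u + finsetExponent B)) ⊆ largeColumns P a (columns u) := by
  intro j hj
  obtain ⟨hPj, haj⟩ := mem_largeColumns.1 hj
  refine mem_largeColumns.2 ⟨hPj, fun k => ?_⟩
  have hk : a k + 1 ≤ u (toLex (k, j)) + finsetExponent B (toLex (k, j)) := haj k
  rw [finsetExponent_apply] at hk
  change a k ≤ u (toLex (k, j))
  split_ifs at hk <;> omega

theorem hasConeApex_of_isColumnThreshold {J : (n : ℕ) → Ideal (MvPolynomial (FinVar c n) K)}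
    {N : ℕ} {a : Fin c → ℕ} (hN : IsColumnThreshold (fun n => columnSet (J n)) P N a)
    {m : FinVar c n →₀ ℕ} {x : FinVar c n} (hPx : P ≤ ((ofLex x).2 : ℕ)) (hx : 1 ≤ m x)
    (h : N + p + 1 ≤ (largeColumns P a (columns m)).card ∨
      N ≤ (largeColumns P (a + 1) (columns m)).card) :
    HasConeApex (J n) p m := by
  refine hasConeApex_intro hx fun A u hA hxA hum hu => ?_
  rw [← columns_mem_columnSet]
  refine hN _ _ (columns_mem_columnSet.2 hu) (fun j hj k => ?_) ?_
  · have hne : toLex (k, j) ≠ x := by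
      rintro rfl
      exact hj.not_ge hPx
    rw [columns_apply, Finsupp.add_apply, Finsupp.single_eq_of_ne hne, add_zero, columns_apply]
  · subst hum
    rcases h with hcard | hcard
    · have hle := card_largeColumns_add_finsetExponent_le (P := P) a u (insert x A)
      rw [Finset.card_insert_of_notMem hxA, hA] at hle
      omega
    · exact hcard.trans
        (Finset.card_le_card (largeColumns_succ_add_finsetExponent_subset a u (insert x A)))

end ConeApex

/-! ### Counting columns -/

section Degree

theorem sum_le_of_exceptional {ι : Type*} [Fintype ι] {s : ι → ℕ} {B C : ℕ} {E T : Finset ι}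
    (hB : ∀ j, s j ≤ B) (hE : ∀ j ∉ E, s j ≤ C + 1) (hT : ∀ j ∉ E, j ∉ T → s j ≤ C) :
    ∑ j, s j ≤ C * Fintype.card ι + E.card * B + T.card := by
  classical
  have hs (j : ι) : s j ≤ C + (if j ∈ E then B else 0) + (if j ∈ T then 1 else 0) := by
    have := hB j
    have := hE j
    have := hT j
    split_ifs <;> grind
  refine (Finset.sum_le_sum fun j _ => hs j).trans_eq ?_
  simp [Finset.sum_add_distrib, mul_comm]

theorem sum_le_add_sup_erase {ι : Type*} [Fintype ι] [DecidableEq ι] {a w : ι → ℕ}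
    (haw : ∀ k, a k ≤ w k) (k₀ : ι) :
    ∑ k, a k ≤ a k₀ + Finset.univ.sup fun l => ∑ k ∈ Finset.univ.erase l, w k := by
  rw [← Finset.add_sum_erase _ _ (Finset.mem_univ k₀)]
  refine Nat.add_le_add_left ((Finset.sum_le_sum fun k _ => haw k).trans ?_) _
  exact Finset.le_sup (f := fun l => ∑ k ∈ Finset.univ.erase l, w k) (Finset.mem_univ k₀)

variable {c n P W : ℕ} {m : FinVar c n →₀ ℕ}

theorem degree_eq_sum_columns (m : FinVar c n →₀ ℕ) : m.degree = ∑ j, ∑ k, columns m j k := by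
  rw [Finsupp.degree_eq_sum, ← (toLex (α := Fin c × Fin n)).sum_comp, Fintype.sum_prod_type,
    Finset.sum_comm]
  rfl

theorem card_filter_val_lt_le (n P : ℕ) :
    (Finset.univ.filter fun j : Fin n => (j : ℕ) < P).card ≤ P :=
  Fin.card_filter_val_lt.trans_le (min_le_right _ _)

theorem sum_columns_le (hW : ∀ j k, columns m j k ≤ W) (j : Fin n) :
    ∑ k, columns m j k ≤ c * W := by
  simpa using Finset.sum_le_sum fun k (_ : k ∈ Finset.univ) => hW j k

theorem exists_one_le_of_lt_degree (hW : ∀ j k, columns m j k ≤ W)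
    (hdeg : P * (c * W) < m.degree) : ∃ x, P ≤ ((ofLex x).2 : ℕ) ∧ 1 ≤ m x := by
  contrapose! hdeg
  have hzero (j : Fin n) (hj : j ∉ Finset.univ.filter fun j : Fin n => (j : ℕ) < P) :
      ∑ k, columns m j k = 0 := Finset.sum_eq_zero fun k _ =>
    Nat.lt_one_iff.1 (hdeg (toLex (k, j)) (by simpa using hj))
  have hsum := sum_le_of_exceptional (C := 0) (T := ∅) (sum_columns_le hW)
    (fun j hj => (hzero j hj).trans_le (Nat.zero_le _)) fun j hj _ => (hzero j hj).le
  rw [← degree_eq_sum_columns, zero_mul, zero_add, Finset.card_empty, add_zero] at hsum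
  exact hsum.trans (Nat.mul_le_mul_right _ (card_filter_val_lt_le n P))

theorem degree_le_of_columns_le {w : Fin c → ℕ} (hW : ∀ j k, columns m j k ≤ W)
    (hw : ∀ j : Fin n, P ≤ (j : ℕ) → ∀ k, columns m j k ≤ w k) (ω : ℕ) :
    m.degree ≤ ((ω - 1) + Finset.univ.sup fun l => ∑ k ∈ Finset.univ.erase l, w k) * n +
      (P + (largeColumns P (fun _ => ω + 1) (columns m)).card) * (c * W) +
      (largeColumns P (fun _ => ω) (columns m)).card := by
  classical
  set s := Finset.univ.sup fun l => ∑ k ∈ Finset.univ.erase l, w k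
  set T₀ := largeColumns P (fun _ => ω + 1) (columns m)
  set T := largeColumns P (fun _ => ω) (columns m)
  let E := (Finset.univ.filter fun j : Fin n => (j : ℕ) < P) ∪ T₀
  have hcolumn {j : Fin n} {t : ℕ} (hj : P ≤ (j : ℕ))
      (hsmall : j ∉ largeColumns P (fun _ => t + 1) (columns m)) :
      ∑ k, columns m j k ≤ t + s := by
    obtain ⟨k, hk⟩ : ∃ k, columns m j k < t + 1 := by
      contrapose! hsmall
      exact mem_largeColumns.2 ⟨hj, hsmall⟩
    have := sum_le_add_sup_erase (hw j hj) k
    omega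
  have hEc {j : Fin n} (hj : j ∉ E) : P ≤ (j : ℕ) ∧ j ∉ T₀ := by simpa [E] using hj
  have hE : E.card ≤ P + T₀.card :=
    (Finset.card_union_le _ _).trans (Nat.add_le_add_right (card_filter_val_lt_le n P) _)
  have hsum := sum_le_of_exceptional (C := (ω - 1) + s) (E := E) (T := T) (sum_columns_le hW)
    (fun j hj => (hcolumn (hEc hj).1 (hEc hj).2).trans (by omega)) fun j hj hjT => ?_
  · rw [← degree_eq_sum_columns, Fintype.card_fin] at hsum
    have := Nat.mul_le_mul_right (c * W) hE
    omega
  · rcases ω with - | ω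
    · exact absurd (mem_largeColumns.2 ⟨(hEc hj).1, fun _ => Nat.zero_le _⟩) hjT
    · exact hcolumn (hEc hj).1 hjT

theorem degree_le_of_not_hasConeApex {K : Type*} [Field K]
    {J : (n : ℕ) → Ideal (MvPolynomial (FinVar c n) K)} {N ω p : ℕ} {w : Fin c → ℕ}
    (hN : IsColumnThreshold (fun n => columnSet (J n)) P N fun _ => ω)
    (hW : ∀ g ∈ minGens (J n), ∀ j k, columns g j k ≤ W)
    (hw : ∀ k, idealRowWeight P k (J n) = w k) (hm : ¬ HasConeApex (J n) p m) :
    m.degree ≤ ((ω - 1) + Finset.univ.sup fun l => ∑ k ∈ Finset.univ.erase l, w k) * n +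
      ((P + N) * (c * W) + N) + p := by
  have hmW (j : Fin n) (k : Fin c) : columns m j k ≤ W :=
    le_of_not_hasConeApex hm fun g hg => hW g hg j k
  have hmw (j : Fin n) (hj : P ≤ (j : ℕ)) (k : Fin c) : columns m j k ≤ w k :=
    le_of_not_hasConeApex hm fun g hg => (columns_le_idealRowWeight hg hj k).trans_eq (hw k)
  rcases le_or_gt m.degree (P * (c * W)) with hdeg | hdeg
  · exact hdeg.trans (by nlinarith [Nat.zero_le (N * (c * W))])
  obtain ⟨x, hPx, hx⟩ := exists_one_le_of_lt_degree hmW hdeg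
  have hT : (largeColumns P (fun _ => ω) (columns m)).card ≤ N + p := by
    by_contra! hcard
    exact hm (hasConeApex_of_isColumnThreshold hN hPx hx (Or.inl hcard))
  have hT₀ : (largeColumns P (fun _ => ω + 1) (columns m)).card ≤ N := by
    by_contra! hcard
    exact hm (hasConeApex_of_isColumnThreshold hN hPx hx (Or.inr hcard.le))
  have hsum := degree_le_of_columns_le hmW hmw ω
  have := Nat.mul_le_mul_right (c * W) (Nat.add_le_add_left hT₀ P)
  omega

end Degree

end

theorem mainTheorem2 {K : Type*} [Field K] (c : ℕ) (hc : 1 ≤ c) (i : ℕ)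
    (I : (n : ℕ) → Ideal (MvPolynomial (FinVar c n) K))
    (hgraded : ∀ n, 1 ≤ n → IsGradedIdeal (I n))
    (hinv : IsIncInvariant i I)
    (hnonzero : ∃ n, 1 ≤ n ∧ I n ≠ ⊥)
    (le : (InfVar c →₀ ℕ) → (InfVar c →₀ ℕ) → Prop)
    (hle : IsMonomialOrder le) (hresp : RespectsInc i le) :
    (∀ᶠ i' in Filter.atTop, ∀ᶠ n in Filter.atTop,
      idealOmega i' (initialChain le I n) = chainOmega (initialChain le I)) ∧
    (∀ k : Fin c, ∀ᶠ i' in Filter.atTop, ∀ᶠ n in Filter.atTop,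
      idealRowWeight i' k (initialChain le I n) = chainRowWeight (initialChain le I) k) ∧
    ∃ D : ℤ, ∀ᶠ n : ℕ in Filter.atTop,
      regularity (I n) ≤ (((chainC (initialChain le I) : ℝ) * (n : ℝ) + (D : ℝ) : ℝ) : EReal) := by
  have hJ := isIncClosed_initialChain hinv hle hresp
  have hw := eventually_idealRowWeight_eq_chainRowWeight hJ
  refine ⟨eventually_idealOmega_eq_chainOmega hJ, hw, ?_⟩
  obtain ⟨P, hwP, N, hN⟩ := ((eventually_all.2 hw).and
    (eventually_exists_isColumnThreshold_chainOmega hJ)).exists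
  obtain ⟨W, hW⟩ := exists_eventually_minGens_le hJ
  refine ⟨((P + N) * (c * W) + N : ℕ), ?_⟩
  filter_upwards [eventually_all.2 hwP, hW, eventually_ge_atTop 1] with n hwn hWn hn
  have hcone (p : ℕ) (m : FinVar c n →₀ ℕ)
      (hdeg : chainC (initialChain le I) * n + ((P + N) * (c * W) + N) + p < m.degree) :
      HasConeApex (initialChain le I n) p m := by
    contrapose! hdeg
    exact degree_le_of_not_hasConeApex hN hWn hwn hdeg
  exact_mod_cast regularity_le (hle.restrictOrder n) (hgraded n hn) hcone
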